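/- **Theorem (Preservation for the direct-style $\lambda^*_\varepsilon$-calculus).** *Syntax.* Fix base types $B$, among them $\mathsf{Unit}$ (with the constant $\mathsf{unit}$) and $\mathsf{Alloc}$ (with the allocation capability $\omega$ as its only constant); every constant $c$ belongs to exactly one base type. Let $x,y$ range over variables and $\ell,w$ over store locations, and identify terms and types up to renaming of bound variables. - Values $v ::= c\mid\lambda x.t\mid\ell$; terms $t ::= v\mid x\mid t\,t\mid \mathsf{ref}_{t}\,t\mid {!t}\mid t:=t\mid \mathsf{let}\ x=t\ \mathsf{in}\ t$. - Qualifiers, effects and observations $p,q,r,\varepsilon,\varphi$ are finite sets of variables and locations; a comma denotes union. - Types $T ::= B\mid (x:T^q)\to^{\varepsilon}U^r\mid \mathsf{Ref}\,B$, where $x$ is bound in $\varepsilon,U,r$. - Typing environments $\Gamma$ (resp. store typings $\Sigma$) are finite sequences of bindings $x:T^q$ (resp. $\ell:T^q$) with distinct variables (resp. locations). $q[p/x]$ is $(q\setminus\{x\})\cup p$ if $x\in q$ and $q$ otherwise, extended homomorphically to types. In a context $\Gamma\mid\Sigma$, the saturation $q^*$ is the set of all atoms reachable from $q$ in zero or more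 steps, where an atom bound with qualifier $q'$ reaches in one step each element of $q'$. *Subtyping.* $\Gamma\mid\Sigma\vdash p<:q$ iff $p\subseteq q\subseteq\mathrm{dom}(\Gamma)\cup\mathrm{dom}(\Sigma)$. $\Gamma\mid\Sigma\vdash S^p\,\varepsilon_1<:T^q\,\varepsilon_2$ iff $S<:T$, $p<:q$ and $\varepsilon_1<:\varepsilon_2$. On types: $B<:B$; $\mathsf{Ref}\,B<:\mathsf{Ref}\,B$; and $(x:S^o)\to^{\varepsilon_1}T^q<:(x:U^p)\to^{\varepsilon_2}V^r$ if $\Gamma\mid\Sigma\vdash U^p\,\varnothing<:S^o\,\varnothing$ and $\Gamma,x:U^p\mid\Sigma\vdash T^q\,\varepsilon_1<:V^r\,\varepsilon_2$. *Typing.* $[\Gamma\mid\Sigma]^\varphi\vdash t:T^q\ \varepsilon$ is generated by the following rules (the context $[\Gamma\mid\Sigma]^\varphi$ is omitted where it does not change; variables bound by a term or type are chosen fresh). - $c:B^\varnothing\ \varnothing$ if $c$ belongs to $B$; $\;x:T^{\{x\}}\ \varnothing$ if $x:T^q\in\Gamma$ and $x\in\varphi$; $\;\ell:T^{\{\ell\}}\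 \varnothing$ if $\ell:T^q\in\Sigma$ and $\ell\in\varphi$. - $\lambda x.t:((x:T^p)\to^{\varepsilon}U^r)^q\ \varnothing$ if $[\Gamma,x:T^p\mid\Sigma]^{q,x}\vdash t:U^r\ \varepsilon$, $q\subseteq\varphi$, and all variables and locations in $T^p$ are bound in $\Gamma$ or $\Sigma$. - $t_1\,t_2:(U^r)[p/x]\ \ \varepsilon_1\cup\varepsilon_2\cup\varepsilon_3[p/x]$ if $t_1:((x:T^{p^*\cap q^*})\to^{\varepsilon_3}U^r)^q\ \varepsilon_1$, $t_2:T^p\ \varepsilon_2$, $p^*,q^*\subseteq\varphi$, $x\notin\mathrm{fv}(U)$, $\varepsilon_3\subseteq q,x$ and $r\subseteq\varphi,x$. - $\mathsf{let}\ x=t_1\ \mathsf{in}\ t_2:(T^q)[p/x]\ \ \varepsilon_1\cup\varepsilon_2[p/x]$ if $t_1:S^p\ \varepsilon_1$, $[\Gamma,x:S^{p^*\cap\varphi^*}\mid\Sigma]^{\varphi,x}\vdash t_2:T^q\ \varepsilon_2$ and $x\notin\mathrm{fv}(T)$. - $\mathsf{ref}_{t_1}\,t_2:(\mathsf{Ref}\,B)^\varnothing\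 \ \varepsilon_1\cup\varepsilon_2\cup q$ if $t_1:\mathsf{Alloc}^q\ \varepsilon_1$ and $t_2:B^\varnothing\ \varepsilon_2$. - $!t:B^\varnothing\ \ \varepsilon\cup q$ if $t:(\mathsf{Ref}\,B)^q\ \varepsilon$. - $t_1:=t_2:\mathsf{Unit}^\varnothing\ \ \varepsilon_1\cup\varepsilon_2\cup q$ if $t_1:(\mathsf{Ref}\,B)^q\ \varepsilon_1$ and $t_2:B^\varnothing\ \varepsilon_2$. - $t:T^q\ \varepsilon_2$ if $t:S^p\ \varepsilon_1$, $\Gamma\mid\Sigma\vdash S^p\,\varepsilon_1<:T^q\,\varepsilon_2$ and $q,\varepsilon_2\subseteq\varphi$. *Stores.* A store $\sigma$ is a finite sequence of bindings $w=\omega$ or $\ell=\mathsf{ref}_\omega\,v$. Well-formedness $[\Gamma\mid\Sigma]^\varphi\vdash\sigma$ is generated by: $[\Gamma\mid\varnothing]^\varphi\vdash\varnothing$; $[\Gamma\mid w:\mathsf{Alloc}^\varnothing]^\varphi\vdash(w=\omega)$ (the initial store); and if $[\Gamma\mid\Sigma]^\varphi\vdash\sigma$, $[\Gamma\mid\Sigma]^\varphi\vdash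 v:B^\varnothing\ \varnothing$ and $\ell\notin\mathrm{dom}(\Sigma)$, then $[\Gamma\mid\Sigma,\ell:(\mathsf{Ref}\,B)^\varnothing]^\varphi\vdash\sigma,\ell=\mathsf{ref}_\omega\,v$. *Reduction.* Evaluation contexts are $E ::= \square\mid E\,t\mid v\,E\mid\mathsf{ref}_E\,t\mid\mathsf{ref}_v\,E\mid{!E}\mid E:=t\mid v:=E\mid\mathsf{let}\ x=E\ \mathsf{in}\ t$. One-step call-by-value reduction $\sigma\mid t\longrightarrow\sigma'\mid t'$ is given by: - $\sigma\mid E[(\lambda x.t)\,v]\longrightarrow\sigma\mid E[t[v/x]]$ and $\sigma\mid E[\mathsf{let}\ x=v\ \mathsf{in}\ t]\longrightarrow\sigma\mid E[t[v/x]]$; - $\sigma\mid E[\mathsf{ref}_a\,v]\longrightarrow\sigma,\ell=\mathsf{ref}_\omega\,v\mid E[\ell]$ for $\ell\notin\mathrm{dom}(\sigma)$, where $a$ is $\omega$ or a location $w$ with $w=\omega$ in $\sigma$; - if $\sigma$ contains $\ell=\mathsf{ref}_\omega\,v$: $\sigma\mid E[!\ell]\longrightarrow\sigma\mid E[v]$,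 and $\sigma\mid E[\ell:=v']\longrightarrow\sigma'\mid E[\mathsf{unit}]$, where $\sigma'$ is $\sigma$ with that binding replaced by $\ell=\mathsf{ref}_\omega\,v'$. *Claim.* If $[\varnothing\mid\Sigma]^{\mathrm{dom}(\Sigma)}\vdash t:T^q\ \varepsilon$, $[\varnothing\mid\Sigma]^{\mathrm{dom}(\Sigma)}\vdash\sigma$ and $\sigma\mid t\longrightarrow\sigma'\mid t'$, then there are $\Sigma'\supseteq\Sigma$ and $p\subseteq\mathrm{dom}(\Sigma'\setminus\Sigma)$ such that $$[\varnothing\mid\Sigma']^{\mathrm{dom}(\Sigma')}\vdash t':T^{q\cup p}\ \ \varepsilon\cup p\qquad\text{and}\qquad[\varnothing\mid\Sigma']^{\mathrm{dom}(\Sigma')}\vdash\sigma'.$$ -/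

import Mathlib

/-!
The direct-style `λ*_ε`-calculus: a call-by-value λ-calculus with mutable references, reachability
qualifiers and effects.  Binding is represented in the locally nameless style: bound variables are
de Bruijn indices, free variables and store locations are natural numbers, and the rules that go
under a binder quantify over all fresh names `x` outside a finite set `L`.
-/

namespace LStar

universe u v

/-- Atoms of qualifiers: (bound or free) term variables and store locations. -/
inductive Atom : Type
  | bvar (i : ℕ)
  | fvar (x : ℕ)
  | loc (l : ℕ)
  deriving DecidableEq

/-- Qualifiers, effects and observations: finite sets of variables and locations. -/
abbrev Qual : Type := Finset Atom

/-- Base types: `Unit`, the type `Alloc` of allocation capabilities, and an arbitrary collection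
`K` of further base types. -/
inductive Base (K : Type u) : Type u
  | unit
  | alloc
  | ground (k : K)

/-- Types. In `fn T q ε U r`, i.e. `(x : T^q) →^ε U^r`, the argument `x` is index `0` in
`ε`, `U` and `r`. -/
inductive Ty (K : Type u) : Type u
  | base (B : Base K)
  | fn (T : Ty K) (q : Qual) (ε : Qual) (U : Ty K) (r : Qual)
  | ref (B : Base K)

/-- Constants: `unit`, the allocation capability `ω`, and the elements `C k` of base type `k`. -/
inductive Const {K : Type u} (C : K → Type v) : Type (max u v)
  | unit
  | omega
  | lit (k : K) (c : C k)

/-- The base type to which a constant belongs. -/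
def Const.ty {K : Type u} {C : K → Type v} : Const C → Base K
  | .unit => .unit
  | .omega => .alloc
  | .lit k _ => .ground k

/-- Terms; `lam t` and the second argument of `letin` bind index `0`; `ref t₁ t₂` allocates a cell
with initial content `t₂` using the capability `t₁`. -/
inductive Term {K : Type u} (C : K → Type v) : Type (max u v)
  | const (c : Const C)
  | bvar (i : ℕ)
  | fvar (x : ℕ)
  | loc (l : ℕ)
  | lam (t : Term C)
  | app (t₁ t₂ : Term C)
  | ref (t₁ t₂ : Term C)
  | deref (t : Term C)
  | assign (t₁ t₂ : Term C)
  | letin (t₁ t₂ : Term C)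

/-- Values: constants, abstractions and locations. -/
inductive Value {K : Type u} {C : K → Type v} : Term C → Prop
  | const (c : Const C) : Value (.const c)
  | lam (t : Term C) : Value (.lam t)
  | loc (l : ℕ) : Value (.loc l)

/-! ### Substitution for bound variables -/

/-- Qualifier substitution `q[p/x]` for the variable with index `k`. -/
def Qual.inst (k : ℕ) (p q : Qual) : Qual :=
  if Atom.bvar k ∈ q then q.erase (Atom.bvar k) ∪ p else q

/-- Homomorphic extension of qualifier substitution to types. -/
def Ty.inst {K : Type u} (k : ℕ) (p : Qual) : Ty K → Ty K
  | .base B => .base B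
  | .fn T q ε U r =>
      .fn (T.inst k p) (Qual.inst k p q) (Qual.inst (k + 1) p ε) (U.inst (k + 1) p)
        (Qual.inst (k + 1) p r)
  | .ref B => .ref B

/-- The variable with index `k` does not occur in the type. -/
def Ty.NotFree {K : Type u} (k : ℕ) : Ty K → Prop
  | .base _ => True
  | .fn T q ε U r =>
      T.NotFree k ∧ Atom.bvar k ∉ q ∧ Atom.bvar (k + 1) ∉ ε ∧ U.NotFree (k + 1) ∧
        Atom.bvar (k + 1) ∉ r
  | .ref _ => True

/-- Term substitution `t[s/x]` for the variable with index `k`; only used for locally closed `s`. -/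
def Term.inst {K : Type u} {C : K → Type v} (t : Term C) (k : ℕ) (s : Term C) : Term C :=
  match t with
  | .const c => .const c
  | .bvar i => if i = k then s else .bvar i
  | .fvar x => .fvar x
  | .loc l => .loc l
  | .lam t => .lam (t.inst (k + 1) s)
  | .app t₁ t₂ => .app (t₁.inst k s) (t₂.inst k s)
  | .ref t₁ t₂ => .ref (t₁.inst k s) (t₂.inst k s)
  | .deref t => .deref (t.inst k s)
  | .assign t₁ t₂ => .assign (t₁.inst k s) (t₂.inst k s)
  | .letin t₁ t₂ => .letin (t₁.inst k s) (t₂.inst (k + 1) s)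

/-- A qualifier under one binder, with the bound variable named `x`. -/
abbrev Qual.named (x : ℕ) (q : Qual) : Qual := Qual.inst 0 {Atom.fvar x} q

/-- A type under one binder, with the bound variable named `x`. -/
abbrev Ty.named {K : Type u} (x : ℕ) (T : Ty K) : Ty K := T.inst 0 {Atom.fvar x}

/-- A term under one binder, with the bound variable named `x`. -/
abbrev Term.named {K : Type u} {C : K → Type v} (x : ℕ) (t : Term C) : Term C :=
  t.inst 0 (.fvar x)

/-! ### Typing environments and store typings -/

/-- Typing environments: finite sequences of bindings `x : T^q`, latest first. -/
abbrev Ctx (K : Type u) : Type u := List (ℕ × Ty K × Qual)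

/-- Store typings: finite sequences of bindings `l : T^q`, latest first. -/
abbrev StoreTy (K : Type u) : Type u := List (ℕ × Ty K × Qual)

/-- The domain of a typing environment. -/
def domC {K : Type u} (Γ : Ctx K) : Qual := (Γ.map fun e => Atom.fvar e.1).toFinset

/-- The domain of a store typing. -/
def domS {K : Type u} (Ψ : StoreTy K) : Qual := (Ψ.map fun e => Atom.loc e.1).toFinset

/-- Every atom of `q` is in `D` or is bound by one of the `k` enclosing binders. -/
def Qual.Scoped (D : Qual) (k : ℕ) (q : Qual) : Prop :=
  ∀ a ∈ q, a ∈ D ∨ ∃ i < k, a = Atom.bvar i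

/-- All qualifiers and effects in a type under `k` binders mention only atoms of `D` and bound
variables. -/
def Ty.Scoped {K : Type u} (D : Qual) : ℕ → Ty K → Prop
  | _, .base _ => True
  | k, .fn T q ε U r =>
      T.Scoped D k ∧ Qual.Scoped D k q ∧ Qual.Scoped D (k + 1) ε ∧ U.Scoped D (k + 1) ∧
        Qual.Scoped D (k + 1) r
  | _, .ref _ => True

/-! ### Reachability -/

/-- The one-step reachability relation `a ⇝ b`: the binding of the variable or location `a` has a
qualifier that contains `b`. -/
inductive Reach {K : Type u} (Γ : Ctx K) (Ψ : StoreTy K) : Atom → Atom → Prop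
  | var {x : ℕ} {T : Ty K} {q : Qual} {b : Atom} :
      (x, T, q) ∈ Γ → b ∈ q → Reach Γ Ψ (.fvar x) b
  | loc {l : ℕ} {T : Ty K} {q : Qual} {b : Atom} :
      (l, T, q) ∈ Ψ → b ∈ q → Reach Γ Ψ (.loc l) b

/-- All atoms that occur in the outer qualifiers of a sequence of bindings. -/
def qualAtoms {K : Type u} : List (ℕ × Ty K × Qual) → Qual
  | [] => ∅
  | e :: es => e.2.2 ∪ qualAtoms es

theorem subset_qualAtoms {K : Type u} {es : List (ℕ × Ty K × Qual)} {x : ℕ} {T : Ty K} {q : Qual}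
    (h : (x, T, q) ∈ es) : q ⊆ qualAtoms es := by
  induction es with
  | nil => simp at h
  | cons e es ih =>
    rcases List.mem_cons.1 h with h | h
    · subst h
      exact Finset.subset_union_left
    · exact (ih h).trans Finset.subset_union_right

open Classical in
/-- Saturation `q*`: everything reachable from `q` in zero or more steps (see `mem_sat`). -/
noncomputable def sat {K : Type u} (Γ : Ctx K) (Ψ : StoreTy K) (q : Qual) : Qual :=
  (q ∪ (qualAtoms Γ ∪ qualAtoms Ψ)).filter
    fun b => ∃ a ∈ q, Relation.ReflTransGen (Reach Γ Ψ) a b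

open Classical in
theorem mem_sat {K : Type u} {Γ : Ctx K} {Ψ : StoreTy K} {q : Qual} {b : Atom} :
    b ∈ sat Γ Ψ q ↔ ∃ a ∈ q, Relation.ReflTransGen (Reach Γ Ψ) a b := by
  unfold sat
  rw [Finset.mem_filter]
  refine ⟨fun h => h.2, fun h => ⟨?_, h⟩⟩
  obtain ⟨a, ha, hab⟩ := h
  rcases Relation.ReflTransGen.cases_tail hab with h | ⟨c, _, hcb⟩
  · subst h
    exact Finset.mem_union_left _ ha
  · apply Finset.mem_union_right
    cases hcb with
    | var hm hb => exact Finset.mem_union_left _ (subset_qualAtoms hm hb)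
    | loc hm hb => exact Finset.mem_union_right _ (subset_qualAtoms hm hb)

/-! ### Subtyping -/

/-- Subtyping of qualifiers and of effects. -/
def QSub {K : Type u} (Γ : Ctx K) (Ψ : StoreTy K) (p q : Qual) : Prop :=
  p ⊆ q ∧ q ⊆ domC Γ ∪ domS Ψ

/-- Subtyping of ordinary types. In the rule for functions, the premises of subtyping for qualified
types with effects are written out. -/
inductive TSub {K : Type u} : Ctx K → StoreTy K → Ty K → Ty K → Prop
  | base {Γ : Ctx K} {Ψ : StoreTy K} (B : Base K) : TSub Γ Ψ (.base B) (.base B)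
  | ref {Γ : Ctx K} {Ψ : StoreTy K} (B : Base K) : TSub Γ Ψ (.ref B) (.ref B)
  | fn {Γ : Ctx K} {Ψ : StoreTy K} {S T U V : Ty K} {o p q r ε₁ ε₂ : Qual} (L : Finset ℕ) :
      TSub Γ Ψ U S →
      QSub Γ Ψ p o →
      (∀ x ∉ L, TSub ((x, U, p) :: Γ) Ψ (T.named x) (V.named x)) →
      (∀ x ∉ L, QSub ((x, U, p) :: Γ) Ψ (q.named x) (r.named x)) →
      (∀ x ∉ L, QSub ((x, U, p) :: Γ) Ψ (ε₁.named x) (ε₂.named x)) →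
      TSub Γ Ψ (.fn S o ε₁ T q) (.fn U p ε₂ V r)

/-- Subtyping `S^p ε₁ <: T^q ε₂` of qualified types with effects. -/
def QTSub {K : Type u} (Γ : Ctx K) (Ψ : StoreTy K) (S : Ty K) (p ε₁ : Qual) (T : Ty K)
    (q ε₂ : Qual) : Prop :=
  TSub Γ Ψ S T ∧ QSub Γ Ψ p q ∧ QSub Γ Ψ ε₁ ε₂

/-! ### Term typing -/

/-- `HasType Γ Ψ φ t T q ε`: under the environment `Γ`, the store typing `Ψ` and the observation
`φ`, the term `t` has the qualified type `T^q` and the effect `ε`. Sequential composition of effects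
is union. -/
inductive HasType {K : Type u} {C : K → Type v} :
    Ctx K → StoreTy K → Qual → Term C → Ty K → Qual → Qual → Prop
  | cst {Γ : Ctx K} {Ψ : StoreTy K} {φ : Qual} (c : Const C) :
      HasType Γ Ψ φ (.const c) (.base c.ty) ∅ ∅
  | var {Γ : Ctx K} {Ψ : StoreTy K} {φ : Qual} {x : ℕ} {T : Ty K} {q : Qual} :
      (x, T, q) ∈ Γ → Atom.fvar x ∈ φ →
      HasType Γ Ψ φ (.fvar x) T {Atom.fvar x} ∅
  | loc {Γ : Ctx K} {Ψ : StoreTy K} {φ : Qual} {l : ℕ} {T : Ty K} {q : Qual} :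
      (l, T, q) ∈ Ψ → Atom.loc l ∈ φ →
      HasType Γ Ψ φ (.loc l) T {Atom.loc l} ∅
  | abs {Γ : Ctx K} {Ψ : StoreTy K} {φ : Qual} {t : Term C} {T U : Ty K} {p q r ε : Qual}
      (L : Finset ℕ) :
      -- the new typing assumption `x : T^p` is well-scoped
      T.Scoped (domC Γ ∪ domS Ψ) 0 → p ⊆ domC Γ ∪ domS Ψ →
      (∀ x ∉ L, HasType ((x, T, p) :: Γ) Ψ (q ∪ {Atom.fvar x}) (t.named x)
        (U.named x) (r.named x) (ε.named x)) →
      q ⊆ φ →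
      HasType Γ Ψ φ (.lam t) (.fn T p ε U r) q ∅
  | app {Γ : Ctx K} {Ψ : StoreTy K} {φ : Qual} {t₁ t₂ : Term C} {T U : Ty K}
      {p q r ε₁ ε₂ ε₃ : Qual} :
      HasType Γ Ψ φ t₁ (.fn T (sat Γ Ψ p ∩ sat Γ Ψ q) ε₃ U r) q ε₁ →
      HasType Γ Ψ φ t₂ T p ε₂ →
      -- the intersected saturated qualifiers are observable
      sat Γ Ψ p ⊆ φ → sat Γ Ψ q ⊆ φ →
      U.NotFree 0 → ε₃ ⊆ q ∪ {Atom.bvar 0} → r ⊆ φ ∪ {Atom.bvar 0} →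
      HasType Γ Ψ φ (.app t₁ t₂) (U.inst 0 p) (Qual.inst 0 p r) (ε₁ ∪ ε₂ ∪ Qual.inst 0 p ε₃)
  | letin {Γ : Ctx K} {Ψ : StoreTy K} {φ : Qual} {t₁ t₂ : Term C} {S T : Ty K}
      {p q ε₁ ε₂ : Qual} (L : Finset ℕ) :
      HasType Γ Ψ φ t₁ S p ε₁ →
      (∀ x ∉ L, HasType ((x, S, sat Γ Ψ p ∩ sat Γ Ψ φ) :: Γ) Ψ (φ ∪ {Atom.fvar x}) (t₂.named x)
        (T.named x) (q.named x) (ε₂.named x)) →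
      T.NotFree 0 →
      HasType Γ Ψ φ (.letin t₁ t₂) (T.inst 0 p) (Qual.inst 0 p q) (ε₁ ∪ Qual.inst 0 p ε₂)
  | ref {Γ : Ctx K} {Ψ : StoreTy K} {φ : Qual} {t₁ t₂ : Term C} {B : Base K} {q ε₁ ε₂ : Qual} :
      HasType Γ Ψ φ t₁ (.base .alloc) q ε₁ →
      HasType Γ Ψ φ t₂ (.base B) ∅ ε₂ →
      HasType Γ Ψ φ (.ref t₁ t₂) (.ref B) ∅ (ε₁ ∪ ε₂ ∪ q)
  | deref {Γ : Ctx K} {Ψ : StoreTy K} {φ : Qual} {t : Term C} {B : Base K} {q ε : Qual} :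
      HasType Γ Ψ φ t (.ref B) q ε →
      HasType Γ Ψ φ (.deref t) (.base B) ∅ (ε ∪ q)
  | assign {Γ : Ctx K} {Ψ : StoreTy K} {φ : Qual} {t₁ t₂ : Term C} {B : Base K}
      {q ε₁ ε₂ : Qual} :
      HasType Γ Ψ φ t₁ (.ref B) q ε₁ →
      HasType Γ Ψ φ t₂ (.base B) ∅ ε₂ →
      HasType Γ Ψ φ (.assign t₁ t₂) (.base .unit) ∅ (ε₁ ∪ ε₂ ∪ q)
  | sub {Γ : Ctx K} {Ψ : StoreTy K} {φ : Qual} {t : Term C} {S T : Ty K} {p q ε₁ ε₂ : Qual} :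
      HasType Γ Ψ φ t S p ε₁ →
      QTSub Γ Ψ S p ε₁ T q ε₂ →
      q ⊆ φ → ε₂ ⊆ φ →
      HasType Γ Ψ φ t T q ε₂

/-! ### Stores -/

/-- Store cells: the allocation capability `ω`, or a mutable reference cell with a content. -/
inductive Cell {K : Type u} (C : K → Type v) : Type (max u v)
  | omega
  | ref (s : Term C)

/-- Stores: finite sequences of bindings of locations to cells, latest first. -/
abbrev Store {K : Type u} (C : K → Type v) : Type (max u v) := List (ℕ × Cell C)

/-- Well-formed stores. A store is built by reference allocations from the empty store or from the
initial store, which holds just the allocation capability at some location `w`. -/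
inductive StoreOK {K : Type u} {C : K → Type v} (Γ : Ctx K) (φ : Qual) :
    StoreTy K → Store C → Prop
  | empty : StoreOK Γ φ [] []
  | init (w : ℕ) : StoreOK Γ φ [(w, .base .alloc, ∅)] [(w, .omega)]
  | ref {Ψ : StoreTy K} {σ : Store C} {s : Term C} {B : Base K} {l : ℕ} :
      StoreOK Γ φ Ψ σ →
      Value s → HasType Γ Ψ φ s (.base B) ∅ ∅ →
      Atom.loc l ∉ domS Ψ →
      StoreOK Γ φ ((l, .ref B, ∅) :: Ψ) ((l, .ref s) :: σ)

/-! ### Call-by-value reduction -/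

/-- Call-by-value evaluation contexts. -/
inductive ECtx {K : Type u} (C : K → Type v) : Type (max u v)
  | hole
  | appL (E : ECtx C) (t : Term C)
  | appR (s : Term C) (hs : Value s) (E : ECtx C)
  | refL (E : ECtx C) (t : Term C)
  | refR (s : Term C) (hs : Value s) (E : ECtx C)
  | deref (E : ECtx C)
  | assignL (E : ECtx C) (t : Term C)
  | assignR (s : Term C) (hs : Value s) (E : ECtx C)
  | letin (E : ECtx C) (t : Term C)

/-- Filling the hole of an evaluation context. -/
def ECtx.plug {K : Type u} {C : K → Type v} : ECtx C → Term C → Term C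
  | .hole, a => a
  | .appL E t, a => .app (E.plug a) t
  | .appR s _ E, a => .app s (E.plug a)
  | .refL E t, a => .ref (E.plug a) t
  | .refR s _ E, a => .ref s (E.plug a)
  | .deref E, a => .deref (E.plug a)
  | .assignL E t, a => .assign (E.plug a) t
  | .assignR s _ E, a => .assign s (E.plug a)
  | .letin E t, a => .letin (E.plug a) t

/-- The term denotes the allocation capability: it is the constant `ω`, or a location at which the
store holds `ω`. -/
inductive IsCap {K : Type u} {C : K → Type v} (σ : Store C) : Term C → Prop
  | const : IsCap σ (.const .omega)
  | loc {w : ℕ} : (w, Cell.omega) ∈ σ → IsCap σ (.loc w)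

/-- Contraction of redexes. -/
inductive Head {K : Type u} {C : K → Type v} : Store C → Term C → Store C → Term C → Prop
  | beta {σ : Store C} {t s : Term C} : Value s →
      Head σ (.app (.lam t) s) σ (t.inst 0 s)
  | letin {σ : Store C} {t s : Term C} : Value s →
      Head σ (.letin s t) σ (t.inst 0 s)
  | ref {σ : Store C} {a s : Term C} {l : ℕ} : IsCap σ a → Value s →
      l ∉ σ.map Prod.fst →
      Head σ (.ref a s) ((l, .ref s) :: σ) (.loc l)
  | deref {σ₁ σ₂ : Store C} {l : ℕ} {s : Term C} :
      Head (σ₁ ++ (l, .ref s) :: σ₂) (.deref (.loc l)) (σ₁ ++ (l, .ref s) :: σ₂) s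
  | assign {σ₁ σ₂ : Store C} {l : ℕ} {s s' : Term C} : Value s' →
      Head (σ₁ ++ (l, .ref s) :: σ₂) (.assign (.loc l) s')
        (σ₁ ++ (l, .ref s') :: σ₂) (.const .unit)

/-- Single-step call-by-value reduction `σ ∣ t ⟶ σ' ∣ t'`. -/
inductive Step {K : Type u} {C : K → Type v} : Store C → Term C → Store C → Term C → Prop
  | ctx {σ σ' : Store C} {t t' : Term C} (E : ECtx C) :
      Head σ t σ' t' → Step σ (E.plug t) σ' (E.plug t')

end LStar

namespace LStar

universe u v

variable {K : Type u} {C : K → Type v}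

/-! ### Substitution for free variables -/

/-- Qualifier substitution for the free variable `x`. -/
def Qual.subst (x : ℕ) (p q : Qual) : Qual :=
  if Atom.fvar x ∈ q then q.erase (Atom.fvar x) ∪ p else q

/-- Homomorphic extension of `Qual.subst` to types. -/
def Ty.subst (x : ℕ) (p : Qual) : Ty K → Ty K
  | .base B => .base B
  | .fn T q ε U r =>
      .fn (T.subst x p) (Qual.subst x p q) (Qual.subst x p ε) (U.subst x p) (Qual.subst x p r)
  | .ref B => .ref B

/-- Term substitution for the free variable `x`; only used for locally closed `s`. -/
def Term.subst (t : Term C) (x : ℕ) (s : Term C) : Term C :=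
  match t with
  | .const c => .const c
  | .bvar i => .bvar i
  | .fvar y => if y = x then s else .fvar y
  | .loc l => .loc l
  | .lam t => .lam (t.subst x s)
  | .app t₁ t₂ => .app (t₁.subst x s) (t₂.subst x s)
  | .ref t₁ t₂ => .ref (t₁.subst x s) (t₂.subst x s)
  | .deref t => .deref (t.subst x s)
  | .assign t₁ t₂ => .assign (t₁.subst x s) (t₂.subst x s)
  | .letin t₁ t₂ => .letin (t₁.subst x s) (t₂.subst x s)

namespace Qual

theorem mem_inst {k : ℕ} {p q : Qual} {a : Atom} :
    a ∈ Qual.inst k p q ↔ (a ∈ q ∧ a ≠ .bvar k) ∨ (Atom.bvar k ∈ q ∧ a ∈ p) := by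
  unfold Qual.inst
  split_ifs with h <;> grind

theorem mem_subst {x : ℕ} {p q : Qual} {a : Atom} :
    a ∈ Qual.subst x p q ↔ (a ∈ q ∧ a ≠ .fvar x) ∨ (Atom.fvar x ∈ q ∧ a ∈ p) := by
  unfold Qual.subst
  split_ifs with h <;> grind

theorem inst_mono {k : ℕ} {p p' q q' : Qual} (hp : p ⊆ p') (hq : q ⊆ q') :
    Qual.inst k p q ⊆ Qual.inst k p' q' := by
  intro a
  simp only [mem_inst]
  grind

theorem subst_mono {x : ℕ} {p q q' : Qual} (hq : q ⊆ q') :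
    Qual.subst x p q ⊆ Qual.subst x p q' := by
  intro a
  simp only [mem_subst]
  grind

theorem subst_of_notMem {x : ℕ} {p q : Qual} (h : Atom.fvar x ∉ q) : Qual.subst x p q = q := by
  simp [Qual.subst, h]

theorem subst_union {x : ℕ} {p q r : Qual} :
    Qual.subst x p (q ∪ r) = Qual.subst x p q ∪ Qual.subst x p r := by
  ext a
  simp only [mem_subst, Finset.mem_union]
  grind

theorem subst_inst {x k : ℕ} {p p' q : Qual} (hp : ∀ i, Atom.bvar i ∉ p) :
    Qual.subst x p (Qual.inst k p' q) = Qual.inst k (Qual.subst x p p') (Qual.subst x p q) := by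
  ext a
  have := hp k
  simp only [mem_subst, mem_inst]
  grind

theorem subst_named_self {x k : ℕ} {p q : Qual} (hx : Atom.fvar x ∉ q) :
    Qual.subst x p (Qual.inst k {.fvar x} q) = Qual.inst k p q := by
  ext a
  simp only [mem_subst, mem_inst, Finset.mem_singleton]
  grind

theorem subst_singleton_ne {x y : ℕ} {p : Qual} (h : y ≠ x) :
    Qual.subst x p {.fvar y} = {.fvar y} :=
  subst_of_notMem (by simpa using h.symm)

theorem Scoped.mono {D D' : Qual} {k k' : ℕ} {q : Qual} (hD : D ⊆ D') (hk : k ≤ k')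
    (h : Qual.Scoped D k q) : Qual.Scoped D' k' q := by
  intro a ha
  rcases h a ha with h | ⟨i, hi, h⟩
  · exact .inl (hD h)
  · exact .inr ⟨i, by omega, h⟩

theorem scoped_zero {D q : Qual} : Qual.Scoped D 0 q ↔ q ⊆ D := by
  simp [Qual.Scoped, Finset.subset_iff]

theorem Scoped.inst {D p q : Qual} {k : ℕ} (h : Qual.Scoped D (k + 1) q) (hp : p ⊆ D) :
    Qual.Scoped D k (Qual.inst k p q) := by
  intro a ha
  rcases mem_inst.1 ha with ⟨h1, h2⟩ | ⟨_, h2⟩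
  · rcases h a h1 with h | ⟨i, hi, rfl⟩
    · exact .inl h
    · refine .inr ⟨i, ?_, rfl⟩
      have : i ≠ k := fun e => h2 (e ▸ rfl)
      omega
  · exact .inl (hp h2)

theorem Scoped.subst {D D' p q : Qual} {k x : ℕ} (h : Qual.Scoped D k q) (hp : p ⊆ D')
    (hD : ∀ a ∈ D, a ≠ .fvar x → a ∈ D') : Qual.Scoped D' k (Qual.subst x p q) := by
  intro a ha
  rcases mem_subst.1 ha with ⟨h1, h2⟩ | ⟨_, h2⟩
  · rcases h a h1 with h | h
    · exact .inl (hD a h h2)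
    · exact .inr h
  · exact .inl (hp h2)

theorem Scoped.of_named {D q : Qual} {k : ℕ} (L : Finset ℕ)
    (h : ∀ x ∉ L, Qual.Scoped (insert (.fvar x) D) k (Qual.inst k {.fvar x} q)) :
    Qual.Scoped D (k + 1) q := by
  intro a ha
  by_cases hk : a = .bvar k
  · exact .inr ⟨k, by omega, hk⟩
  · have key : ∃ x ∉ L, a ≠ .fvar x := by
      cases a with
      | fvar y =>
        obtain ⟨x, hx⟩ := Infinite.exists_notMem_finset (insert y L)
        refine ⟨x, by grind, ?_⟩
        grind
      | _ =>
        obtain ⟨x, hx⟩ := Infinite.exists_notMem_finset L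
        exact ⟨x, hx, by simp⟩
    obtain ⟨x, hx, hax⟩ := key
    rcases h x hx a (mem_inst.2 (.inl ⟨ha, hk⟩)) with h | ⟨i, hi, h⟩
    · exact .inl ((Finset.mem_insert.1 h).resolve_left hax)
    · exact .inr ⟨i, by omega, h⟩

theorem inst_subset_of_named {p q φ : Qual} (L : Finset ℕ)
    (h : ∀ x ∉ L, Qual.named x q ⊆ φ ∪ {.fvar x}) (hp : p ⊆ φ) : Qual.inst 0 p q ⊆ φ := by
  have : Qual.Scoped φ 1 q := Scoped.of_named L fun x hx => scoped_zero.2 <| by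
    have := h x hx
    intro a ha
    have := this ha
    grind
  exact scoped_zero.1 (this.inst hp)

theorem Scoped.notFree {D q : Qual} {k : ℕ} (h : Qual.Scoped D (k + 1) q)
    (hk : Atom.bvar k ∉ q) : Qual.Scoped D k q := by
  intro a ha
  rcases h a ha with h | ⟨i, hi, rfl⟩
  · exact .inl h
  · refine .inr ⟨i, ?_, rfl⟩
    have : i ≠ k := fun e => hk (e ▸ ha)
    omega

theorem Scoped.inst_eq {D p q : Qual} {k j : ℕ} (h : Qual.Scoped D k q)
    (hD : ∀ i, Atom.bvar i ∉ D) (hj : k ≤ j) : Qual.inst j p q = q := by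
  have : Atom.bvar j ∉ q := by
    intro hq
    rcases h _ hq with h | ⟨i, hi, h⟩
    · exact hD _ h
    · cases h; omega
  simp [Qual.inst, this]

theorem Scoped.subst_eq {D p q : Qual} {k x : ℕ} (h : Qual.Scoped D k q)
    (hx : Atom.fvar x ∉ D) : Qual.subst x p q = q := by
  refine subst_of_notMem fun hq => ?_
  rcases h _ hq with h | ⟨i, hi, h⟩
  · exact hx h
  · cases h

end Qual

namespace Ty

theorem Scoped.mono {D D' : Qual} {T : Ty K} {k k' : ℕ} (hD : D ⊆ D') (hk : k ≤ k')
    (h : T.Scoped D k) : T.Scoped D' k' := by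
  induction T generalizing k k' with
  | fn T q ε U r ihT ihU =>
    obtain ⟨h1, h2, h3, h4, h5⟩ := h
    exact ⟨ihT hk h1, h2.mono hD hk, h3.mono hD (by omega), ihU (by omega) h4,
      h5.mono hD (by omega)⟩
  | _ => trivial

theorem Scoped.inst {D p : Qual} {T : Ty K} {k : ℕ} (h : T.Scoped D (k + 1)) (hp : p ⊆ D) :
    (T.inst k p).Scoped D k := by
  induction T generalizing k with
  | fn T q ε U r ihT ihU =>
    obtain ⟨h1, h2, h3, h4, h5⟩ := h
    exact ⟨ihT h1, h2.inst hp, h3.inst hp, ihU h4, h5.inst hp⟩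
  | _ => trivial

theorem Scoped.subst {D D' p : Qual} {T : Ty K} {k x : ℕ} (h : T.Scoped D k) (hp : p ⊆ D')
    (hD : ∀ a ∈ D, a ≠ .fvar x → a ∈ D') : (T.subst x p).Scoped D' k := by
  induction T generalizing k with
  | fn T q ε U r ihT ihU =>
    obtain ⟨h1, h2, h3, h4, h5⟩ := h
    exact ⟨ihT h1, h2.subst hp hD, h3.subst hp hD, ihU h4, h5.subst hp hD⟩
  | _ => trivial

theorem Scoped.of_named {D : Qual} {T : Ty K} {k : ℕ} (L : Finset ℕ)
    (h : ∀ x ∉ L, (T.inst k {.fvar x}).Scoped (insert (.fvar x) D) k) : T.Scoped D (k + 1) := by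
  induction T generalizing k with
  | fn T q ε U r ihT ihU =>
    exact ⟨ihT fun x hx => (h x hx).1, .of_named L fun x hx => (h x hx).2.1,
      .of_named L fun x hx => (h x hx).2.2.1, ihU fun x hx => (h x hx).2.2.2.1,
      .of_named L fun x hx => (h x hx).2.2.2.2⟩
  | _ => trivial

theorem Scoped.notFree {D : Qual} {T : Ty K} {k : ℕ} (h : T.Scoped D (k + 1))
    (hk : T.NotFree k) : T.Scoped D k := by
  induction T generalizing k with
  | fn T q ε U r ihT ihU =>
    obtain ⟨h1, h2, h3, h4, h5⟩ := h
    obtain ⟨g1, g2, g3, g4, g5⟩ := hk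
    exact ⟨ihT h1 g1, h2.notFree g2, h3.notFree g3, ihU h4 g4, h5.notFree g5⟩
  | _ => trivial

theorem Scoped.inst_eq {D p : Qual} {T : Ty K} {k j : ℕ} (h : T.Scoped D k)
    (hD : ∀ i, Atom.bvar i ∉ D) (hj : k ≤ j) : T.inst j p = T := by
  induction T generalizing k j with
  | fn T q ε U r ihT ihU =>
    obtain ⟨h1, h2, h3, h4, h5⟩ := h
    simp only [Ty.inst, ihT h1 hj, h2.inst_eq hD hj, h3.inst_eq hD (Nat.succ_le_succ hj),
      ihU h4 (Nat.succ_le_succ hj), h5.inst_eq hD (Nat.succ_le_succ hj)]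
  | _ => rfl

theorem Scoped.subst_eq {D p : Qual} {T : Ty K} {k x : ℕ} (h : T.Scoped D k)
    (hx : Atom.fvar x ∉ D) : T.subst x p = T := by
  induction T generalizing k with
  | fn T q ε U r ihT ihU =>
    obtain ⟨h1, h2, h3, h4, h5⟩ := h
    simp only [Ty.subst, ihT h1, h2.subst_eq hx, h3.subst_eq hx, ihU h4, h5.subst_eq hx]
  | _ => rfl

theorem Scoped.isNotFree {D : Qual} {T : Ty K} {k j : ℕ} (h : T.Scoped D k)
    (hD : ∀ i, Atom.bvar i ∉ D) (hj : k ≤ j) : T.NotFree j := by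
  have key : ∀ {q : Qual} {k j : ℕ}, Qual.Scoped D k q → k ≤ j → Atom.bvar j ∉ q := by
    intro q k j h hj hq
    rcases h _ hq with h | ⟨i, hi, h⟩
    · exact hD _ h
    · cases h; omega
  induction T generalizing k j with
  | fn T q ε U r ihT ihU =>
    obtain ⟨h1, h2, h3, h4, h5⟩ := h
    exact ⟨ihT h1 hj, key h2 hj, key h3 (by omega), ihU h4 (by omega), key h5 (by omega)⟩
  | _ => trivial

theorem subst_inst {x k : ℕ} {p p' : Qual} {T : Ty K} (hp : ∀ i, Atom.bvar i ∉ p) :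
    (T.inst k p').subst x p = (T.subst x p).inst k (Qual.subst x p p') := by
  induction T generalizing k with
  | fn T q ε U r ihT ihU => simp only [Ty.subst, Ty.inst, ihT, ihU, Qual.subst_inst hp]
  | _ => rfl

theorem Scoped.subst_named_self {D : Qual} {x k j : ℕ} {p : Qual} {T : Ty K} (h : T.Scoped D j)
    (hx : Atom.fvar x ∉ D) : (T.inst k {.fvar x}).subst x p = T.inst k p := by
  have key : ∀ {q : Qual} {k : ℕ}, Qual.Scoped D k q → Atom.fvar x ∉ q := by
    intro q k h hq
    rcases h _ hq with h | ⟨i, hi, h⟩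
    · exact hx h
    · cases h
  induction T generalizing k j with
  | fn T q ε U r ihT ihU =>
    obtain ⟨h1, h2, h3, h4, h5⟩ := h
    simp only [Ty.subst, Ty.inst, ihT h1, ihU h4, Qual.subst_named_self (key h2),
      Qual.subst_named_self (key h3), Qual.subst_named_self (key h5)]
  | _ => rfl

/-- The type is not a function type. -/
def Simple : Ty K → Prop
  | .fn .. => False
  | _ => True

theorem Simple.scoped {T : Ty K} (h : T.Simple) (D : Qual) (k : ℕ) : T.Scoped D k := by
  cases T <;> trivial

end Ty

namespace Term

/-- No bound variable of the term is dangling. -/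
def LC (t : Term C) : Prop := ∀ k s, t.inst k s = t

theorem inst_eq_of_inst_inst {t : Term C} {i j : ℕ} {s s' : Term C} (hij : i ≠ j)
    (h : (t.inst j s').inst i s = t.inst j s') : t.inst i s = t := by
  induction t generalizing i j with
  | bvar m =>
    by_cases hm : m = j
    · simp [Term.inst, hm, hij.symm]
    · simpa [Term.inst, hm] using h
  | lam t ih =>
    simp only [Term.inst, Term.lam.injEq] at h ⊢
    exact ih (by omega) h
  | app t₁ t₂ ih1 ih2 =>
    simp only [Term.inst, Term.app.injEq] at h ⊢
    exact ⟨ih1 hij h.1, ih2 hij h.2⟩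
  | ref t₁ t₂ ih1 ih2 =>
    simp only [Term.inst, Term.ref.injEq] at h ⊢
    exact ⟨ih1 hij h.1, ih2 hij h.2⟩
  | deref t ih =>
    simp only [Term.inst, Term.deref.injEq] at h ⊢
    exact ih hij h
  | assign t₁ t₂ ih1 ih2 =>
    simp only [Term.inst, Term.assign.injEq] at h ⊢
    exact ⟨ih1 hij h.1, ih2 hij h.2⟩
  | letin t₁ t₂ ih1 ih2 =>
    simp only [Term.inst, Term.letin.injEq] at h ⊢
    exact ⟨ih1 hij h.1, ih2 (by omega) h.2⟩
  | _ => rfl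

theorem subst_named {x y k : ℕ} {s t : Term C} (hs : s.LC) (hxy : y ≠ x) :
    (t.inst k (.fvar y)).subst x s = (t.subst x s).inst k (.fvar y) := by
  induction t generalizing k with
  | bvar i =>
    simp only [Term.inst, Term.subst]
    split_ifs <;> simp [Term.subst, hxy]
  | fvar z =>
    simp only [Term.inst, Term.subst]
    split_ifs
    · exact (hs _ _).symm
    · rfl
  | _ => simp_all [Term.inst, Term.subst]

/-- The free variables of a term. -/
def fv : Term C → Finset ℕ
  | .const _ => ∅
  | .bvar _ => ∅
  | .fvar x => {x}
  | .loc _ => ∅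
  | .lam t => t.fv
  | .app t₁ t₂ => t₁.fv ∪ t₂.fv
  | .ref t₁ t₂ => t₁.fv ∪ t₂.fv
  | .deref t => t.fv
  | .assign t₁ t₂ => t₁.fv ∪ t₂.fv
  | .letin t₁ t₂ => t₁.fv ∪ t₂.fv

theorem subst_named_self {x k : ℕ} {s t : Term C} (hx : x ∉ t.fv) :
    (t.inst k (.fvar x)).subst x s = t.inst k s := by
  induction t generalizing k with
  | bvar i =>
    simp only [Term.inst]
    split_ifs <;> simp [Term.subst]
  | fvar z =>
    have : z ≠ x := fun h => hx (by simp [fv, h])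
    simp [Term.inst, Term.subst, this]
  | _ => simp_all [Term.inst, Term.subst, fv]

theorem subst_self {x : ℕ} {t : Term C} : t.subst x (.fvar x) = t := by
  induction t with
  | fvar z =>
    simp only [Term.subst]
    split_ifs with h
    · rw [h]
    · rfl
  | _ => simp_all [Term.subst]

end Term

/-- Typable terms are locally closed. -/
theorem HasType.lc {Γ : Ctx K} {Ψ : StoreTy K} {φ : Qual} {t : Term C} {T : Ty K} {q ε : Qual}
    (h : HasType Γ Ψ φ t T q ε) : t.LC := by
  induction h with
  | cst | var | loc => exact fun _ _ => rfl
  | abs L _ _ _ _ ih =>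
    intro k s
    obtain ⟨x, hx⟩ := Infinite.exists_notMem_finset L
    simp only [Term.inst, Term.lam.injEq]
    exact Term.inst_eq_of_inst_inst (Nat.succ_ne_zero k) (ih x hx _ _)
  | letin L _ _ _ ih1 ih2 =>
    intro k s
    obtain ⟨x, hx⟩ := Infinite.exists_notMem_finset L
    simp only [Term.inst, Term.letin.injEq]
    exact ⟨ih1 _ _, Term.inst_eq_of_inst_inst (Nat.succ_ne_zero k) (ih2 x hx _ _)⟩
  | app _ _ _ _ _ _ _ ih1 ih2 | ref _ _ ih1 ih2 | assign _ _ ih1 ih2 =>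
    intro k s
    simp only [Term.inst, ih1 k s, ih2 k s]
  | deref _ ih =>
    intro k s
    simp only [Term.inst, ih k s]
  | sub _ _ _ _ ih => exact ih

/-! ### Domains and well-formed contexts -/

/-- The joint domain of a typing environment and a store typing. -/
abbrev dom (Γ : Ctx K) (Ψ : StoreTy K) : Qual := domC Γ ∪ domS Ψ

/-- The variables bound by a typing environment. -/
def names (Γ : Ctx K) : Finset ℕ := (Γ.map Prod.fst).toFinset

theorem mem_domC {Γ : Ctx K} {a : Atom} : a ∈ domC Γ ↔ ∃ e ∈ Γ, a = .fvar e.1 := by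
  simp [domC, eq_comm]

theorem mem_domS {Ψ : StoreTy K} {a : Atom} : a ∈ domS Ψ ↔ ∃ e ∈ Ψ, a = .loc e.1 := by
  simp [domS, eq_comm]

theorem mem_names {Γ : Ctx K} {x : ℕ} : x ∈ names Γ ↔ ∃ e ∈ Γ, e.1 = x := by
  simp [names]

@[simp] theorem domC_nil : domC ([] : Ctx K) = ∅ := rfl

@[simp] theorem domC_cons {Γ : Ctx K} {e : ℕ × Ty K × Qual} :
    domC (e :: Γ) = insert (.fvar e.1) (domC Γ) := by
  simp [domC]

@[simp] theorem domS_cons {Ψ : StoreTy K} {e : ℕ × Ty K × Qual} :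
    domS (e :: Ψ) = insert (.loc e.1) (domS Ψ) := by
  simp [domS]

theorem dom_cons {Γ : Ctx K} {Ψ : StoreTy K} {x : ℕ} {e : Ty K × Qual} :
    dom ((x, e) :: Γ) Ψ = insert (.fvar x) (dom Γ Ψ) := by
  simp [dom]

theorem bvar_notMem_dom {Γ : Ctx K} {Ψ : StoreTy K} (i : ℕ) : Atom.bvar i ∉ dom Γ Ψ := by
  simp [mem_domC, mem_domS]

theorem fvar_mem_dom {Γ : Ctx K} {Ψ : StoreTy K} {x : ℕ} :
    Atom.fvar x ∈ dom Γ Ψ ↔ x ∈ names Γ := by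
  simp only [Finset.mem_union, mem_domC, mem_domS, mem_names]
  grind

theorem fvar_notMem_domS {Ψ : StoreTy K} {x : ℕ} : Atom.fvar x ∉ domS Ψ := by
  simp [mem_domS]

theorem mem_domC_of_mem {Γ : Ctx K} {x : ℕ} {T : Ty K} {q : Qual} (h : (x, T, q) ∈ Γ) :
    Atom.fvar x ∈ domC Γ :=
  mem_domC.2 ⟨_, h, rfl⟩

theorem mem_domS_of_mem {Ψ : StoreTy K} {l : ℕ} {T : Ty K} {q : Qual} (h : (l, T, q) ∈ Ψ) :
    Atom.loc l ∈ domS Ψ :=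
  mem_domS.2 ⟨_, h, rfl⟩

theorem union_singleton_subset_insert {D q : Qual} {a : Atom} (h : q ⊆ D) :
    q ∪ {a} ⊆ insert a D :=
  Finset.union_subset (h.trans (Finset.subset_insert _ _)) (by simp)

theorem union_singleton_subset_dom_cons {Γ : Ctx K} {Ψ : StoreTy K} {x : ℕ} {e : Ty K × Qual}
    {q : Qual} (h : q ⊆ dom Γ Ψ) : q ∪ {.fvar x} ⊆ dom ((x, e) :: Γ) Ψ := by
  rw [dom_cons]
  exact union_singleton_subset_insert h

/-- All types and qualifiers in `Γ` are well-scoped, and the locations in `Ψ` have first-order types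
with empty qualifiers. -/
structure WF (Γ : Ctx K) (Ψ : StoreTy K) : Prop where
  ty {x : ℕ} {T : Ty K} {q : Qual} : (x, T, q) ∈ Γ → T.Scoped (dom Γ Ψ) 0
  qual {x : ℕ} {T : Ty K} {q : Qual} : (x, T, q) ∈ Γ → q ⊆ dom Γ Ψ
  simple {l : ℕ} {T : Ty K} {q : Qual} : (l, T, q) ∈ Ψ → T.Simple
  flat {l : ℕ} {T : Ty K} {q : Qual} : (l, T, q) ∈ Ψ → q = ∅

theorem WF.cons {Γ : Ctx K} {Ψ : StoreTy K} (wf : WF Γ Ψ) {x : ℕ} {T : Ty K} {q : Qual}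
    (hT : T.Scoped (dom Γ Ψ) 0) (hq : q ⊆ dom Γ Ψ) : WF ((x, T, q) :: Γ) Ψ := by
  have hsub : dom Γ Ψ ⊆ dom ((x, T, q) :: Γ) Ψ := by
    rw [dom_cons]
    exact Finset.subset_insert _ _
  refine ⟨fun h => ?_, fun h => ?_, wf.simple, wf.flat⟩
  · rcases List.mem_cons.1 h with h | h
    · cases h
      exact hT.mono hsub le_rfl
    · exact (wf.ty h).mono hsub le_rfl
  · rcases List.mem_cons.1 h with h | h
    · cases h
      exact hq.trans hsub
    · exact (wf.qual h).trans hsub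

/-! ### Saturation -/

theorem subset_sat {Γ : Ctx K} {Ψ : StoreTy K} {q : Qual} : q ⊆ sat Γ Ψ q :=
  fun a ha => mem_sat.2 ⟨a, ha, .refl⟩

theorem sat_mono {Γ : Ctx K} {Ψ : StoreTy K} {p q : Qual} (h : p ⊆ q) :
    sat Γ Ψ p ⊆ sat Γ Ψ q := by
  intro a ha
  obtain ⟨b, hb, hab⟩ := mem_sat.1 ha
  exact mem_sat.2 ⟨b, h hb, hab⟩

theorem sat_closed {Γ : Ctx K} {Ψ : StoreTy K} {q : Qual} {a b : Atom} (ha : a ∈ sat Γ Ψ q)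
    (h : Reach Γ Ψ a b) : b ∈ sat Γ Ψ q := by
  obtain ⟨c, hc, hca⟩ := mem_sat.1 ha
  exact mem_sat.2 ⟨c, hc, hca.tail h⟩

theorem sat_subset {Γ : Ctx K} {Ψ : StoreTy K} {q X : Qual} (hq : q ⊆ X)
    (h : ∀ a ∈ X, ∀ b, Reach Γ Ψ a b → b ∈ X) : sat Γ Ψ q ⊆ X := by
  intro b hb
  obtain ⟨a, ha, hab⟩ := mem_sat.1 hb
  induction hab with
  | refl => exact hq ha
  | tail _ hbc ih => exact h _ (ih (mem_sat.2 ⟨_, ha, by assumption⟩)) _ hbc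

theorem WF.reach {Γ : Ctx K} {Ψ : StoreTy K} (wf : WF Γ Ψ) {a b : Atom} (h : Reach Γ Ψ a b) :
    b ∈ dom Γ Ψ := by
  cases h with
  | var hm hb => exact wf.qual hm hb
  | loc hm hb => simp [wf.flat hm] at hb

theorem WF.sat_subset_dom {Γ : Ctx K} {Ψ : StoreTy K} (wf : WF Γ Ψ) {q : Qual}
    (hq : q ⊆ dom Γ Ψ) : sat Γ Ψ q ⊆ dom Γ Ψ :=
  sat_subset hq fun _ _ _ h => wf.reach h

theorem WF.sat_nil {Ψ : StoreTy K} (wf : WF [] Ψ) {q : Qual} : sat [] Ψ q = q := by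
  refine (sat_subset subset_rfl fun a _ b h => ?_).antisymm subset_sat
  cases h with
  | var hm _ => simp at hm
  | loc hm hb => simp [wf.flat hm] at hb

/-! ### Subtyping -/

theorem QSub.mono {Γ Γ' : Ctx K} {Ψ Ψ' : StoreTy K} {p q : Qual} (hd : dom Γ Ψ ⊆ dom Γ' Ψ')
    (h : QSub Γ Ψ p q) : QSub Γ' Ψ' p q :=
  ⟨h.1, h.2.trans hd⟩

theorem dom_cons_subset {Γ Γ' : Ctx K} {Ψ Ψ' : StoreTy K} {x : ℕ} {e e' : Ty K × Qual}
    (hd : dom Γ Ψ ⊆ dom Γ' Ψ') : dom ((x, e) :: Γ) Ψ ⊆ dom ((x, e') :: Γ') Ψ' := by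
  rw [dom_cons, dom_cons]
  exact Finset.insert_subset_insert _ hd

theorem TSub.mono {Γ Γ' : Ctx K} {Ψ Ψ' : StoreTy K} {S T : Ty K} (hd : dom Γ Ψ ⊆ dom Γ' Ψ')
    (h : TSub Γ Ψ S T) : TSub Γ' Ψ' S T := by
  induction h generalizing Γ' Ψ' with
  | base => exact .base _
  | ref => exact .ref _
  | fn L _ h2 _ h4 h5 ih1 ih3 =>
    exact .fn L (ih1 hd) (h2.mono hd) (fun x hx => ih3 x hx (dom_cons_subset hd))
      (fun x hx => (h4 x hx).mono (dom_cons_subset hd))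
      (fun x hx => (h5 x hx).mono (dom_cons_subset hd))

theorem TSub.trans_aux {Γ : Ctx K} {Ψ : StoreTy K} {S T : Ty K} (h : TSub Γ Ψ S T) :
    (∀ U, TSub Γ Ψ T U → TSub Γ Ψ S U) ∧ (∀ R, TSub Γ Ψ R S → TSub Γ Ψ R T) := by
  induction h with
  | base => exact ⟨fun _ h => h, fun _ h => h⟩
  | ref => exact ⟨fun _ h => h, fun _ h => h⟩
  | @fn Γ Ψ S T U V o p q r ε₁ ε₂ L h1 h2 h3 h4 h5 ih1 ih3 =>
    constructor
    · intro W hW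
      cases hW with
      | @fn _ _ _ _ U' V' _ p' _ r' _ ε₃ L' g1 g2 g3 g4 g5 =>
        refine .fn (L ∪ L') (ih1.2 _ g1) ⟨g2.1.trans h2.1, h2.2⟩ (fun x hx => ?_) (fun x hx => ?_)
          (fun x hx => ?_) <;> simp only [Finset.mem_union, not_or] at hx
        · exact ((ih3 x hx.1).1 _ ((g3 x hx.2).mono (dom_cons_subset subset_rfl))).mono
            (dom_cons_subset subset_rfl)
        · exact ⟨(h4 x hx.1).1.trans (g4 x hx.2).1, (g4 x hx.2).2⟩
        · exact ⟨(h5 x hx.1).1.trans (g5 x hx.2).1, (g5 x hx.2).2⟩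
    · intro W hW
      cases hW with
      | @fn _ _ S' T' _ _ o' _ q' _ ε₃ _ L' g1 g2 g3 g4 g5 =>
        refine .fn (L ∪ L') (ih1.1 _ g1) ⟨h2.1.trans g2.1, g2.2⟩ (fun x hx => ?_) (fun x hx => ?_)
          (fun x hx => ?_) <;> simp only [Finset.mem_union, not_or] at hx
        · exact (ih3 x hx.1).2 _ ((g3 x hx.2).mono (dom_cons_subset subset_rfl))
        · exact ⟨(g4 x hx.2).1.trans (h4 x hx.1).1, (h4 x hx.1).2⟩
        · exact ⟨(g5 x hx.2).1.trans (h5 x hx.1).1, (h5 x hx.1).2⟩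

theorem TSub.trans {Γ : Ctx K} {Ψ : StoreTy K} {S T U : Ty K} (h : TSub Γ Ψ S T)
    (h' : TSub Γ Ψ T U) : TSub Γ Ψ S U :=
  h.trans_aux.1 _ h'

theorem TSub.scoped {Γ : Ctx K} {Ψ : StoreTy K} {S T : Ty K} (h : TSub Γ Ψ S T) :
    S.Scoped (dom Γ Ψ) 0 ∧ T.Scoped (dom Γ Ψ) 0 := by
  induction h with
  | base => exact ⟨trivial, trivial⟩
  | ref => exact ⟨trivial, trivial⟩
  | fn L _ h2 _ h4 h5 ih1 ih3 =>
    refine ⟨⟨ih1.2, Qual.scoped_zero.2 h2.2, .of_named L fun x hx => ?_,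
      .of_named L fun x hx => ?_, .of_named L fun x hx => ?_⟩, ⟨ih1.1,
      Qual.scoped_zero.2 (h2.1.trans h2.2), .of_named L fun x hx => ?_,
      .of_named L fun x hx => ?_, .of_named L fun x hx => ?_⟩⟩
    · exact Qual.scoped_zero.2 (((h5 x hx).1.trans (h5 x hx).2).trans dom_cons.subset)
    · exact (ih3 x hx).1.mono dom_cons.subset le_rfl
    · exact Qual.scoped_zero.2 (((h4 x hx).1.trans (h4 x hx).2).trans dom_cons.subset)
    · exact Qual.scoped_zero.2 ((h5 x hx).2.trans dom_cons.subset)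
    · exact (ih3 x hx).2.mono dom_cons.subset le_rfl
    · exact Qual.scoped_zero.2 ((h4 x hx).2.trans dom_cons.subset)

/-- The number of constructors of a type. -/
def Ty.height : Ty K → ℕ
  | .fn T _ _ U _ => T.height + U.height + 1
  | _ => 0

theorem Ty.height_inst {k : ℕ} {p : Qual} {T : Ty K} : (T.inst k p).height = T.height := by
  induction T generalizing k with
  | fn T q ε U r ihT ihU => simp only [Ty.inst, Ty.height, ihT, ihU]
  | _ => rfl

theorem TSub.refl {Γ : Ctx K} {Ψ : StoreTy K} {T : Ty K} (h : T.Scoped (dom Γ Ψ) 0) :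
    TSub Γ Ψ T T := by
  generalize hn : T.height = n
  induction n using Nat.strong_induction_on generalizing T Γ with
  | _ n ih =>
    cases T with
    | base => exact .base _
    | ref => exact .ref _
    | fn T q ε U r =>
      obtain ⟨h1, h2, h3, h4, h5⟩ := h
      simp only [Ty.height] at hn
      have key {q : Qual} {x : ℕ} (hq : Qual.Scoped (dom Γ Ψ) 1 q) {e : ℕ × Ty K × Qual} :
          QSub ((x, e.2) :: Γ) Ψ (q.named x) (q.named x) := by
        refine ⟨subset_rfl, Finset.Subset.trans (Qual.scoped_zero.1 (Qual.Scoped.inst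
          (hq.mono (Finset.subset_insert (.fvar x) _) le_rfl) (by simp))) dom_cons.superset⟩
      refine .fn ∅ (ih _ (by omega) h1 rfl) ⟨subset_rfl, Qual.scoped_zero.1 h2⟩ (fun x _ => ?_)
        (fun x _ => key (e := (0, T, q)) h5) (fun x _ => key (e := (0, T, q)) h3)
      refine ih _ ?_ ?_ rfl
      · rw [Ty.height_inst]
        omega
      · exact (Ty.Scoped.inst (h4.mono (Finset.subset_insert (.fvar x) _) le_rfl) (by simp)).mono
          dom_cons.superset le_rfl

theorem QSub.subst {Γ Γ' : Ctx K} {Ψ : StoreTy K} {x : ℕ} {P p q : Qual}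
    (hP : P ⊆ dom Γ' Ψ) (hd : ∀ a ∈ dom Γ Ψ, a ≠ .fvar x → a ∈ dom Γ' Ψ) (h : QSub Γ Ψ p q) :
    QSub Γ' Ψ (Qual.subst x P p) (Qual.subst x P q) :=
  ⟨Qual.subst_mono h.1,
    Qual.scoped_zero.1 (Qual.Scoped.subst (Qual.scoped_zero.2 h.2) hP hd)⟩

theorem TSub.subst {Γ Γ' : Ctx K} {Ψ : StoreTy K} {x : ℕ} {P : Qual} {S T : Ty K}
    (hP : P ⊆ dom Γ' Ψ) (hd : ∀ a ∈ dom Γ Ψ, a ≠ .fvar x → a ∈ dom Γ' Ψ) (h : TSub Γ Ψ S T) :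
    TSub Γ' Ψ (S.subst x P) (T.subst x P) := by
  induction h generalizing Γ' with
  | base => exact .base _
  | ref => exact .ref _
  | @fn Γ Ψ S T U V o p q r ε₁ ε₂ L _ h2 _ h4 h5 ih1 ih3 =>
    have hb : ∀ i, Atom.bvar i ∉ P := fun i hi => bvar_notMem_dom i (hP hi)
    have hP' {y : ℕ} {e : Ty K × Qual} : P ⊆ dom ((y, e) :: Γ') Ψ := by
      rw [dom_cons]
      exact hP.trans (Finset.subset_insert _ _)
    have hd' {y : ℕ} {e e' : Ty K × Qual} : ∀ a ∈ dom ((y, e) :: Γ) Ψ, a ≠ .fvar x →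
        a ∈ dom ((y, e') :: Γ') Ψ := by
      intro a
      rw [dom_cons, dom_cons, Finset.mem_insert, Finset.mem_insert]
      exact fun h hx => h.imp_right fun h => hd a h hx
    refine .fn (insert x L) (ih1 hP hd) (h2.subst hP hd) (fun y hy => ?_) (fun y hy => ?_)
      (fun y hy => ?_) <;> rw [Finset.mem_insert, not_or] at hy
    · have := ih3 y hy.2 (hP' (e := (U.subst x P, Qual.subst x P p))) hd'
      rwa [Ty.subst_inst hb, Ty.subst_inst hb, Qual.subst_singleton_ne hy.1] at this
    · have := (h4 y hy.2).subst (hP' (e := (U.subst x P, Qual.subst x P p))) hd'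
      rwa [Qual.subst_inst hb, Qual.subst_inst hb, Qual.subst_singleton_ne hy.1] at this
    · have := (h5 y hy.2).subst (hP' (e := (U.subst x P, Qual.subst x P p))) hd'
      rwa [Qual.subst_inst hb, Qual.subst_inst hb, Qual.subst_singleton_ne hy.1] at this

/-! ### Regularity of typing -/

/-- The qualifier and the effect of a typable term are observable, and its type is well-scoped. -/
theorem HasType.regular {Γ : Ctx K} {Ψ : StoreTy K} {φ : Qual} {t : Term C} {T : Ty K}
    {q ε : Qual} (h : HasType Γ Ψ φ t T q ε) (wf : WF Γ Ψ) (hφ : φ ⊆ dom Γ Ψ) :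
    T.Scoped (dom Γ Ψ) 0 ∧ q ⊆ φ ∧ ε ⊆ φ := by
  induction h with
  | cst => exact ⟨trivial, by simp, by simp⟩
  | var hm hx => exact ⟨wf.ty hm, by simpa using hx, by simp⟩
  | loc hm hl => exact ⟨(wf.simple hm).scoped _ _, by simpa using hl, by simp⟩
  | abs L hT hp _ hq ih =>
    have ih x hx := ih x hx (wf.cons hT hp) (union_singleton_subset_dom_cons (hq.trans hφ))
    refine ⟨⟨hT, Qual.scoped_zero.2 hp, .of_named L fun x hx => ?_, .of_named L fun x hx => ?_,
      .of_named L fun x hx => ?_⟩, hq, by simp⟩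
    · exact Qual.scoped_zero.2 ((ih x hx).2.2.trans (union_singleton_subset_insert (hq.trans hφ)))
    · exact (ih x hx).1.mono dom_cons.subset le_rfl
    · exact Qual.scoped_zero.2 ((ih x hx).2.1.trans (union_singleton_subset_insert (hq.trans hφ)))
  | app _ _ hp hq _ hε hr ih1 ih2 =>
    obtain ⟨⟨hT, _, _, hU, _⟩, hq1, hε1⟩ := ih1 wf hφ
    obtain ⟨_, hp2, hε2⟩ := ih2 wf hφ
    refine ⟨hU.inst (hp2.trans hφ), ?_, ?_⟩
    · intro a ha
      rcases Qual.mem_inst.1 ha with ⟨h1, h2⟩ | ⟨_, h⟩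
      · have := hr h1
        grind
      · exact hp2 h
    · refine Finset.union_subset (Finset.union_subset hε1 hε2) fun a ha => ?_
      rcases Qual.mem_inst.1 ha with ⟨h1, h2⟩ | ⟨_, h⟩
      · have := hε h1
        have := @hq1 a
        grind
      · exact hp2 h
  | letin L _ _ _ ih1 ih2 =>
    obtain ⟨hS, hp, hε1⟩ := ih1 wf hφ
    have ih x hx := ih2 x hx (wf.cons hS (Finset.inter_subset_right.trans (wf.sat_subset_dom hφ)))
      (union_singleton_subset_dom_cons hφ)
    refine ⟨Ty.Scoped.inst (.of_named L fun x hx => ?_) (hp.trans hφ), ?_,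
      Finset.union_subset hε1 ?_⟩
    · exact (ih x hx).1.mono dom_cons.subset le_rfl
    · exact Qual.inst_subset_of_named L (fun x hx => (ih x hx).2.1) hp
    · exact Qual.inst_subset_of_named L (fun x hx => (ih x hx).2.2) hp
  | ref _ _ ih1 ih2 | assign _ _ ih1 ih2 =>
    exact ⟨trivial, by simp, Finset.union_subset (Finset.union_subset (ih1 wf hφ).2.2
      (ih2 wf hφ).2.2) (ih1 wf hφ).2.1⟩
  | deref _ ih =>
    exact ⟨trivial, by simp, Finset.union_subset (ih wf hφ).2.2 (ih wf hφ).2.1⟩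
  | sub _ hs hq hε _ => exact ⟨hs.1.scoped.2, hq, hε⟩

theorem HasType.up {Γ : Ctx K} {Ψ : StoreTy K} {φ : Qual} {t : Term C} {T : Ty K}
    {q q' ε ε' : Qual} (h : HasType Γ Ψ φ t T q ε) (wf : WF Γ Ψ) (hφ : φ ⊆ dom Γ Ψ)
    (hq : q ⊆ q') (hq' : q' ⊆ φ) (hε : ε ⊆ ε') (hε' : ε' ⊆ φ) : HasType Γ Ψ φ t T q' ε' :=
  .sub h ⟨.refl (h.regular wf hφ).1, ⟨hq, hq'.trans hφ⟩, ⟨hε, hε'.trans hφ⟩⟩ hq' hε'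

/-- The rule for applications, for functions that accept a larger argument qualifier. -/
theorem HasType.app_of_subset {Γ : Ctx K} {Ψ : StoreTy K} {φ : Qual} {t₁ t₂ : Term C}
    {T U : Ty K} {o p q r ε₁ ε₂ ε₃ : Qual} (wf : WF Γ Ψ) (hφ : φ ⊆ dom Γ Ψ)
    (h1 : HasType Γ Ψ φ t₁ (.fn T o ε₃ U r) q ε₁) (h2 : HasType Γ Ψ φ t₂ T p ε₂)
    (ho : sat Γ Ψ p ∩ sat Γ Ψ q ⊆ o) (hp : sat Γ Ψ p ⊆ φ) (hq : sat Γ Ψ q ⊆ φ)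
    (hU : U.NotFree 0) (hε : ε₃ ⊆ q ∪ {.bvar 0}) (hr : r ⊆ φ ∪ {.bvar 0}) :
    HasType Γ Ψ φ (.app t₁ t₂) (U.inst 0 p) (Qual.inst 0 p r)
      (ε₁ ∪ ε₂ ∪ Qual.inst 0 p ε₃) := by
  obtain ⟨⟨hT, ho', hε₃, hU', hr'⟩, hq1, hε1⟩ := h1.regular wf hφ
  refine .app (.sub h1 ⟨?_, ⟨subset_rfl, hq1.trans hφ⟩, ⟨subset_rfl, hε1.trans hφ⟩⟩ hq1 hε1) h2 hp
    hq hU hε hr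
  have hs : TSub Γ Ψ (.fn T o ε₃ U r) (.fn T o ε₃ U r) := .refl ⟨hT, ho', hε₃, hU', hr'⟩
  cases hs with
  | fn L g1 g2 g3 g4 g5 =>
    refine .fn L g1 ⟨ho, g2.2⟩ (fun x hx => ?_) (fun x hx => ?_) (fun x hx => ?_)
    · exact (g3 x hx).mono (dom_cons_subset subset_rfl)
    · exact (g4 x hx).mono (dom_cons_subset subset_rfl)
    · exact (g5 x hx).mono (dom_cons_subset subset_rfl)

/-! ### Weakening and narrowing -/

theorem Reach.cons {Γ : Ctx K} {Ψ : StoreTy K} {e : ℕ × Ty K × Qual} {a b : Atom}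
    (h : Reach Γ Ψ a b) : Reach (e :: Γ) Ψ a b := by
  cases h with
  | var hm hb => exact .var (List.mem_cons_of_mem _ hm) hb
  | loc hm hb => exact .loc hm hb

/-- `Γ', Ψ'` contains the bindings of `Γ, Ψ`, with smaller qualifiers. -/
structure Ext (Γ : Ctx K) (Ψ : StoreTy K) (Γ' : Ctx K) (Ψ' : StoreTy K) : Prop where
  var {x : ℕ} {T : Ty K} {q : Qual} : (x, T, q) ∈ Γ → ∃ q', (x, T, q') ∈ Γ'
  loc {l : ℕ} {T : Ty K} {q : Qual} : (l, T, q) ∈ Ψ → ∃ q', (l, T, q') ∈ Ψ'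
  reach {a b : Atom} : a ∈ dom Γ Ψ → Reach Γ' Ψ' a b → Reach Γ Ψ a b

theorem Ext.dom_subset {Γ Γ' : Ctx K} {Ψ Ψ' : StoreTy K} (h : Ext Γ Ψ Γ' Ψ') :
    dom Γ Ψ ⊆ dom Γ' Ψ' := by
  intro a ha
  rcases Finset.mem_union.1 ha with ha | ha
  · obtain ⟨⟨x, T, q⟩, he, rfl⟩ := mem_domC.1 ha
    obtain ⟨q', h'⟩ := h.var he
    exact Finset.mem_union_left _ (mem_domC_of_mem h')
  · obtain ⟨⟨x, T, q⟩, he, rfl⟩ := mem_domS.1 ha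
    obtain ⟨q', h'⟩ := h.loc he
    exact Finset.mem_union_right _ (mem_domS_of_mem h')

theorem Ext.sat_subset {Γ Γ' : Ctx K} {Ψ Ψ' : StoreTy K} (h : Ext Γ Ψ Γ' Ψ') (wf : WF Γ Ψ)
    {q : Qual} (hq : q ⊆ dom Γ Ψ) : sat Γ' Ψ' q ⊆ sat Γ Ψ q :=
  LStar.sat_subset subset_sat fun _ ha _ hab =>
    sat_closed ha (h.reach (wf.sat_subset_dom hq ha) hab)

theorem Ext.cons {Γ Γ' : Ctx K} {Ψ Ψ' : StoreTy K} (h : Ext Γ Ψ Γ' Ψ') {x : ℕ} {T : Ty K}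
    {q q' : Qual} (hx : x ∉ names Γ') (hq : q' ⊆ q) :
    Ext ((x, T, q) :: Γ) Ψ ((x, T, q') :: Γ') Ψ' := by
  refine ⟨fun hm => ?_, h.loc, fun ha hab => ?_⟩
  · rcases List.mem_cons.1 hm with hm | hm
    · cases hm
      exact ⟨q', List.mem_cons_self⟩
    · obtain ⟨r, hr⟩ := h.var hm
      exact ⟨r, List.mem_cons_of_mem _ hr⟩
  · rw [dom_cons, Finset.mem_insert] at ha
    cases hab with
    | var hm hb =>
      rcases List.mem_cons.1 hm with hm | hm
      · cases hm
        exact .var List.mem_cons_self (hq hb)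
      · refine (h.reach (ha.resolve_left ?_) (.var hm hb)).cons
        rintro ⟨⟩
        exact hx (mem_names.2 ⟨_, hm, rfl⟩)
    | loc hm hb => exact (h.reach (ha.resolve_left (by simp)) (.loc hm hb)).cons

theorem Ext.rfl {Γ : Ctx K} {Ψ : StoreTy K} : Ext Γ Ψ Γ Ψ :=
  ⟨fun h => ⟨_, h⟩, fun h => ⟨_, h⟩, fun _ h => h⟩

theorem HasType.weaken {Γ Γ' : Ctx K} {Ψ Ψ' : StoreTy K} {φ φ' : Qual} {t : Term C} {T : Ty K}
    {q ε : Qual} (h : HasType Γ Ψ φ t T q ε) (wf : WF Γ Ψ) (hφ : φ ⊆ dom Γ Ψ)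
    (ext : Ext Γ Ψ Γ' Ψ') (wf' : WF Γ' Ψ') (hφφ' : φ ⊆ φ') (hφ' : φ' ⊆ dom Γ' Ψ') :
    HasType Γ' Ψ' φ' t T q ε := by
  induction h generalizing Γ' φ' with
  | cst c => exact .cst c
  | var hm hx =>
    obtain ⟨q', hm'⟩ := ext.var hm
    exact .var hm' (hφφ' hx)
  | loc hm hl =>
    obtain ⟨q', hm'⟩ := ext.loc hm
    exact .loc hm' (hφφ' hl)
  | abs L hT hp _ hq ih =>
    have hT' := hT.mono ext.dom_subset le_rfl
    have hp' := hp.trans ext.dom_subset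
    refine .abs (L ∪ names Γ') hT' hp' (fun x hx => ?_) (hq.trans hφφ')
    rw [Finset.mem_union, not_or] at hx
    exact ih x hx.1 (wf.cons hT hp) (union_singleton_subset_dom_cons (hq.trans hφ))
      (ext.cons hx.2 subset_rfl) (wf'.cons hT' hp') subset_rfl
      (union_singleton_subset_dom_cons ((hq.trans hφ).trans ext.dom_subset))
  | app h1 h2 hp hq hU hε hr ih1 ih2 =>
    have hp' := ext.sat_subset wf ((h2.regular wf hφ).2.1.trans hφ)
    have hq' := ext.sat_subset wf ((h1.regular wf hφ).2.1.trans hφ)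
    exact .app_of_subset wf' hφ' (ih1 wf hφ ext wf' hφφ' hφ') (ih2 wf hφ ext wf' hφφ' hφ')
      (Finset.inter_subset_inter hp' hq') ((hp'.trans hp).trans hφφ') ((hq'.trans hq).trans hφφ')
      hU hε (hr.trans (Finset.union_subset_union_left hφφ'))
  | letin L h1 _ hT ih1 ih2 =>
    obtain ⟨hS, hp, _⟩ := h1.regular wf hφ
    refine .letin (L ∪ names Γ') (ih1 wf hφ ext wf' hφφ' hφ') (fun x hx => ?_) hT
    rw [Finset.mem_union, not_or] at hx
    refine ih2 x hx.1
      (wf.cons hS (Finset.inter_subset_right.trans (wf.sat_subset_dom hφ)))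
      (union_singleton_subset_dom_cons hφ)
      (ext.cons hx.2 (Finset.inter_subset_left.trans ?_))
      (wf'.cons (hS.mono ext.dom_subset le_rfl)
        (Finset.inter_subset_right.trans (wf'.sat_subset_dom hφ')))
      (Finset.union_subset_union_left hφφ') (union_singleton_subset_dom_cons hφ')
    exact (ext.sat_subset wf (hp.trans hφ)).trans (Finset.subset_inter subset_rfl (sat_mono hp))
  | ref _ _ ih1 ih2 =>
    exact .ref (ih1 wf hφ ext wf' hφφ' hφ') (ih2 wf hφ ext wf' hφφ' hφ')
  | deref _ ih => exact .deref (ih wf hφ ext wf' hφφ' hφ')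
  | assign _ _ ih1 ih2 =>
    exact .assign (ih1 wf hφ ext wf' hφφ' hφ') (ih2 wf hφ ext wf' hφφ' hφ')
  | sub _ hs hq hε ih =>
    exact .sub (ih wf hφ ext wf' hφφ' hφ') ⟨hs.1.mono ext.dom_subset, hs.2.1.mono ext.dom_subset,
      hs.2.2.mono ext.dom_subset⟩ (hq.trans hφφ') (hε.trans hφφ')

/-- The rule for `let`, for bodies that are typed with a larger qualifier of the bound variable. -/
theorem HasType.letin_of_subset {Γ : Ctx K} {Ψ : StoreTy K} {φ : Qual} {t₁ t₂ : Term C}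
    {S T : Ty K} {o p q ε₁ ε₂ : Qual} (wf : WF Γ Ψ) (hφ : φ ⊆ dom Γ Ψ) (L : Finset ℕ)
    (h1 : HasType Γ Ψ φ t₁ S p ε₁) (ho : sat Γ Ψ p ⊆ o) (ho' : o ⊆ dom Γ Ψ)
    (h2 : ∀ x ∉ L, HasType ((x, S, o) :: Γ) Ψ (φ ∪ {.fvar x}) (t₂.named x) (T.named x)
      (q.named x) (ε₂.named x))
    (hT : T.NotFree 0) :
    HasType Γ Ψ φ (.letin t₁ t₂) (T.inst 0 p) (Qual.inst 0 p q) (ε₁ ∪ Qual.inst 0 p ε₂) := by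
  have hS := (h1.regular wf hφ).1
  refine .letin (L ∪ names Γ) h1 (fun x hx => ?_) hT
  rw [Finset.mem_union, not_or] at hx
  exact (h2 x hx.1).weaken (wf.cons hS ho') (union_singleton_subset_dom_cons hφ)
    (Ext.rfl.cons hx.2 (Finset.inter_subset_left.trans ho))
    (wf.cons hS (Finset.inter_subset_right.trans (wf.sat_subset_dom hφ))) subset_rfl
    (union_singleton_subset_dom_cons hφ)

/-! ### Typing of values -/

/-- A value has no effect, and all it needs to observe is its qualifier. -/
theorem HasType.value {Γ : Ctx K} {Ψ : StoreTy K} {φ : Qual} {s : Term C} {T : Ty K}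
    {q ε : Qual} (h : HasType Γ Ψ φ s T q ε) (hs : Value s) (wf : WF Γ Ψ) (hφ : φ ⊆ dom Γ Ψ) :
    HasType Γ Ψ q s T q ∅ := by
  induction h with
  | cst c => exact .cst c
  | loc hm hl => exact .loc hm (by simp)
  | abs L hT hp h hq _ => exact .abs L hT hp h subset_rfl
  | sub h hsub hq hε ih =>
    have ih := ih hs wf hφ
    have hq' := hq.trans hφ
    refine .sub (ih.weaken wf (hsub.2.1.1.trans hq') .rfl wf hsub.2.1.1 hq')
      ⟨hsub.1, hsub.2.1, ⟨subset_rfl, by simp⟩⟩ subset_rfl (by simp)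
  | _ => cases hs

theorem HasType.const_of_value {Γ : Ctx K} {Ψ : StoreTy K} {φ : Qual} {s : Term C}
    {B : Base K} {ε : Qual} (h : HasType Γ Ψ φ s (.base B) ∅ ε) (hs : Value s) :
    ∃ c : Const C, s = .const c ∧ c.ty = B := by
  generalize hT : Ty.base B = T at h
  generalize hq : (∅ : Qual) = q at h
  induction h with
  | cst c =>
    cases hT
    exact ⟨c, rfl, rfl⟩
  | loc => exact absurd hq (Finset.singleton_ne_empty _).symm
  | abs => cases hT
  | sub h hsub _ _ ih =>
    subst hT hq
    obtain ⟨hT, hq, _⟩ := hsub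
    cases hT
    exact ih hs rfl (Finset.subset_empty.1 hq.1).symm
  | _ => cases hs

theorem HasType.loc_inv {Γ : Ctx K} {Ψ : StoreTy K} {φ : Qual} {l : ℕ} {T : Ty K}
    {q ε : Qual} (h : HasType (C := C) Γ Ψ φ (.loc l) T q ε) :
    ∃ S r, (l, S, r) ∈ Ψ ∧ (S = T ∨ TSub Γ Ψ S T) ∧ Atom.loc l ∈ q := by
  generalize ht : Term.loc l = t at h
  induction h with
  | loc hm _ =>
    cases ht
    exact ⟨_, _, hm, .inl rfl, by simp⟩
  | sub _ hsub _ _ ih =>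
    obtain ⟨S, r, hm, hS, hq⟩ := ih ht
    refine ⟨S, r, hm, .inr ?_, hsub.2.1.1 hq⟩
    rcases hS with rfl | hS
    · exact hsub.1
    · exact hS.trans hsub.1
  | _ => cases ht

theorem HasType.lam_inv {Γ : Ctx K} {Ψ : StoreTy K} {φ : Qual} {t : Term C} {F : Ty K}
    {q ε : Qual} (h : HasType Γ Ψ φ (.lam t) F q ε) (wf : WF Γ Ψ) (hφ : φ ⊆ dom Γ Ψ) :
    ∃ (T U : Ty K) (p r ε' q' : Qual) (L : Finset ℕ),
      T.Scoped (dom Γ Ψ) 0 ∧ p ⊆ dom Γ Ψ ∧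
      (∀ x ∉ L, HasType ((x, T, p) :: Γ) Ψ (q' ∪ {.fvar x}) (t.named x) (U.named x) (r.named x)
        (ε'.named x)) ∧
      q' ⊆ q ∧ TSub Γ Ψ (.fn T p ε' U r) F := by
  generalize ht : Term.lam t = t' at h
  induction h with
  | abs L hT hp h hq ih =>
    cases ht
    exact ⟨_, _, _, _, _, _, L, hT, hp, h, subset_rfl,
      .refl (HasType.regular (.abs L hT hp h hq) wf hφ).1⟩
  | sub _ hsub _ _ ih =>
    obtain ⟨T, U, p, r, ε', q', L, hT, hp, h, hq, hF⟩ := ih wf hφ ht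
    exact ⟨T, U, p, r, ε', q', L, hT, hp, h, hq.trans hsub.2.1.1, hF.trans hsub.1⟩
  | _ => cases ht

/-! ### Substitution -/

/-- Homomorphic extension of `Qual.subst` to typing environments. -/
def substCtx (x : ℕ) (P : Qual) (Γ : Ctx K) : Ctx K :=
  Γ.map fun e => (e.1, e.2.1.subst x P, Qual.subst x P e.2.2)

theorem names_substCtx {x : ℕ} {P : Qual} {Γ : Ctx K} : names (substCtx x P Γ) = names Γ := by
  simp [names, substCtx, Function.comp_def]

theorem domC_substCtx {x : ℕ} {P : Qual} {Γ : Ctx K} : domC (substCtx x P Γ) = domC Γ := by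
  simp [domC, substCtx, Function.comp_def]

theorem domC_append {Γ Γ' : Ctx K} : domC (Γ ++ Γ') = domC Γ ∪ domC Γ' := by
  simp [domC]

/-- The term `s : T^P` in context `Γt`, which binds at most `x`, can be substituted for
`x : T^p₀`. -/
structure Replaces (Γt : Ctx K) (Ψ : StoreTy K) (x : ℕ) (T : Ty K) (p₀ P : Qual) (s : Term C) :
    Prop where
  wf : WF Γt Ψ
  names_subset : names Γt ⊆ {x}
  typed : HasType Γt Ψ P s T P ∅
  subset_dom : P ⊆ dom Γt Ψ
  ty_scoped : T.Scoped (domS Ψ) 0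
  qual_subset : p₀ ⊆ domS Ψ
  reach {a b : Atom} : a ∈ P → Reach Γt Ψ a b → b ∈ P ∪ p₀

section Replaces

variable {Γt Γ : Ctx K} {Ψ : StoreTy K} {x : ℕ} {T : Ty K} {p₀ P : Qual} {s : Term C}

theorem Replaces.bvar_notMem (R : Replaces Γt Ψ x T p₀ P s) (i : ℕ) : Atom.bvar i ∉ P :=
  fun h => bvar_notMem_dom i (R.subset_dom h)

theorem Replaces.fvar_eq (R : Replaces Γt Ψ x T p₀ P s) {y : ℕ} (h : Atom.fvar y ∈ P) :
    y = x := by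
  simpa using R.names_subset (fvar_mem_dom.1 (R.subset_dom h))

theorem Replaces.subset (R : Replaces Γt Ψ x T p₀ P s) :
    P ⊆ dom (substCtx x P Γ ++ Γt) Ψ := by
  intro a ha
  have := R.subset_dom ha
  simp only [Finset.mem_union, domC_append] at this ⊢
  tauto

theorem Replaces.mem_dom {a : Atom} (ha : a ∈ dom (Γ ++ [(x, T, p₀)]) Ψ) (hx : a ≠ .fvar x) :
    a ∈ dom (substCtx x P Γ ++ Γt) Ψ := by
  simp only [Finset.mem_union, domC_append, domC_cons, domC_substCtx, domC_nil,
    Finset.mem_insert] at ha ⊢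
  have : a ∉ (∅ : Qual) := by simp
  tauto

theorem Replaces.qual_dom (R : Replaces Γt Ψ x T p₀ P s) {q : Qual}
    (hq : q ⊆ dom (Γ ++ [(x, T, p₀)]) Ψ) :
    Qual.subst x P q ⊆ dom (substCtx x P Γ ++ Γt) Ψ :=
  Qual.scoped_zero.1 ((Qual.scoped_zero.2 hq).subst R.subset fun _ => mem_dom)

theorem Replaces.target_wf (R : Replaces Γt Ψ x T p₀ P s) (wf : WF (Γ ++ [(x, T, p₀)]) Ψ) :
    WF (substCtx x P Γ ++ Γt) Ψ := by
  have hsub : dom Γt Ψ ⊆ dom (substCtx x P Γ ++ Γt) Ψ := by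
    rw [dom, dom, domC_append]
    exact Finset.union_subset_union_left Finset.subset_union_right
  refine ⟨fun h => ?_, fun h => ?_, wf.simple, wf.flat⟩
  · rcases List.mem_append.1 h with h | h
    · obtain ⟨⟨y, S, q⟩, hm, he⟩ := List.mem_map.1 h
      cases he
      exact (wf.ty (List.mem_append_left _ hm)).subst R.subset fun _ => mem_dom
    · exact (R.wf.ty h).mono hsub le_rfl
  · rcases List.mem_append.1 h with h | h
    · obtain ⟨⟨y, S, q⟩, hm, he⟩ := List.mem_map.1 h
      cases he
      exact R.qual_dom (wf.qual (List.mem_append_left _ hm))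
    · exact (R.wf.qual h).trans hsub

theorem Replaces.target_reach (R : Replaces Γt Ψ x T p₀ P s) (hx : x ∉ names Γ) {a b : Atom}
    (ha : a ∈ dom Γt Ψ) (h : Reach (substCtx x P Γ ++ Γt) Ψ a b) : Reach Γt Ψ a b := by
  cases h with
  | @var y S q _ hm hb =>
    rcases List.mem_append.1 hm with hm | hm
    · have hy : y ∈ names Γ := by
        rw [← names_substCtx (x := x) (P := P)]
        exact mem_names.2 ⟨_, hm, rfl⟩
      have : y = x := by simpa using R.names_subset (fvar_mem_dom.1 ha)
      exact absurd (this ▸ hy) hx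
    · exact .var hm hb
  | loc hm hb => exact .loc hm hb

theorem Replaces.sat_subset (R : Replaces Γt Ψ x T p₀ P s) (hx : x ∉ names Γ) {q : Qual} :
    sat (substCtx x P Γ ++ Γt) Ψ (Qual.subst x P q) ⊆
      Qual.subst x P (sat (Γ ++ [(x, T, p₀)]) Ψ q) := by
  refine LStar.sat_subset (Qual.subst_mono subset_sat) fun a ha b hab => ?_
  rcases Qual.mem_subst.1 ha with ⟨ha, hax⟩ | ⟨hxq, ha⟩
  · cases hab with
    | var hm hb =>
      rcases List.mem_append.1 hm with hm | hm
      · obtain ⟨⟨y, S, q'⟩, hm', he⟩ := List.mem_map.1 hm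
        cases he
        exact Qual.subst_mono (fun c hc => sat_closed ha (.var (List.mem_append_left _ hm') hc)) hb
      · have := R.names_subset (mem_names.2 ⟨_, hm, rfl⟩)
        simp_all
    | loc hm hb => simp [R.wf.flat hm] at hb
  · rcases Finset.mem_union.1 (R.reach ha (R.target_reach hx (R.subset_dom ha) hab)) with h | h
    · exact Qual.mem_subst.2 (.inr ⟨hxq, h⟩)
    · refine Qual.mem_subst.2 (.inl ⟨sat_closed hxq (.var (List.mem_append_right _ List.mem_cons_self) h), ?_⟩)
      rintro rfl
      exact fvar_notMem_domS (R.qual_subset h)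

theorem Replaces.inter_subset (R : Replaces Γt Ψ x T p₀ P s) (hx : x ∉ names Γ) {φ p q : Qual}
    (hp : sat (Γ ++ [(x, T, p₀)]) Ψ p ⊆ φ) (hq : sat (Γ ++ [(x, T, p₀)]) Ψ q ⊆ φ)
    (hP : P ∩ φ ⊆ p₀ ∪ {.fvar x}) :
    sat (substCtx x P Γ ++ Γt) Ψ (Qual.subst x P p) ∩
        sat (substCtx x P Γ ++ Γt) Ψ (Qual.subst x P q) ⊆
      Qual.subst x P (sat (Γ ++ [(x, T, p₀)]) Ψ p ∩ sat (Γ ++ [(x, T, p₀)]) Ψ q) := by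
  intro b hb
  obtain ⟨h1, h2⟩ := Finset.mem_inter.1 hb
  have h1 := Qual.mem_subst.1 (R.sat_subset hx h1)
  have h2 := Qual.mem_subst.1 (R.sat_subset hx h2)
  rw [Qual.mem_subst]
  have key {q : Qual} (hxq : Atom.fvar x ∈ sat (Γ ++ [(x, T, p₀)]) Ψ q) (hbP : b ∈ P)
      (hbφ : b ∈ φ) (hbx : b ≠ .fvar x) : b ∈ sat (Γ ++ [(x, T, p₀)]) Ψ q := by
    have := hP (Finset.mem_inter.2 ⟨hbP, hbφ⟩)
    rw [Finset.mem_union, Finset.mem_singleton] at this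
    exact sat_closed hxq (.var (List.mem_append_right _ List.mem_cons_self) (this.resolve_right hbx))
  simp only [Finset.mem_inter]
  rcases h1 with ⟨h1, h1'⟩ | ⟨h1, h1'⟩ <;> rcases h2 with ⟨h2, h2'⟩ | ⟨h2, h2'⟩
  · exact .inl ⟨⟨h1, h2⟩, h1'⟩
  · exact .inl ⟨⟨h1, key h2 h2' (hp h1) h1'⟩, h1'⟩
  · exact .inl ⟨⟨key h1 h1' (hq h2) h2', h2⟩, h2'⟩
  · exact .inr ⟨⟨h1, h2⟩, h1'⟩

theorem subset_union_bvar_subst {q r : Qual} (h : q ⊆ r ∪ {.bvar 0}) :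
    Qual.subst x P q ⊆ Qual.subst x P r ∪ {.bvar 0} := by
  refine (Qual.subst_mono h).trans_eq ?_
  rw [Qual.subst_union, Qual.subst_of_notMem (q := {Atom.bvar 0}) (by simp)]

theorem HasType.subst_aux {Γ' : Ctx K} {φ : Qual} {t : Term C} {U : Ty K} {q ε : Qual}
    (h : HasType Γ' Ψ φ t U q ε) (hΓ : Γ' = Γ ++ [(x, T, p₀)]) (hx : x ∉ names Γ)
    (R : Replaces Γt Ψ x T p₀ P s) (wf : WF Γ' Ψ) (hφ : φ ⊆ dom Γ' Ψ)
    (hP : P ∩ φ ⊆ p₀ ∪ {.fvar x}) :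
    HasType (substCtx x P Γ ++ Γt) Ψ (Qual.subst x P φ) (t.subst x s) (U.subst x P)
      (Qual.subst x P q) (Qual.subst x P ε) := by
  have hP' {Γ : Ctx K} {Ψ : StoreTy K} (R : Replaces Γt Ψ x T p₀ P s) {φ : Qual}
      (hP : P ∩ φ ⊆ p₀ ∪ {.fvar x}) {y : ℕ} (hy : y ≠ x) :
      P ∩ (φ ∪ {.fvar y}) ⊆ p₀ ∪ {.fvar x} := by
    intro a ha
    have h1 := @hP a
    have h2 := @R.fvar_eq
    grind
  induction h generalizing Γ with
  | cst c => exact .cst c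
  | @var Γ' Ψ φ y S q hm hy =>
    subst hΓ
    simp only [Term.subst]
    split_ifs with hyx
    · subst hyx
      have : S = T := by
        rcases List.mem_append.1 hm with hm | hm
        · exact absurd (mem_names.2 ⟨_, hm, rfl⟩) hx
        · simp at hm
          exact hm.1
      subst this
      have hPφ : P ⊆ Qual.subst y P φ := fun a ha => Qual.mem_subst.2 (.inr ⟨hy, ha⟩)
      have h1 : Qual.subst y P {.fvar y} = P := by
        ext a
        simp only [Qual.mem_subst, Finset.mem_singleton]
        grind
      rw [R.ty_scoped.subst_eq fvar_notMem_domS, h1, Qual.subst_of_notMem (q := ∅) (by simp)]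
      exact R.typed.weaken R.wf R.subset_dom
        ⟨fun h => ⟨_, List.mem_append_right _ h⟩, fun h => ⟨_, h⟩, R.target_reach hx⟩
        (R.target_wf wf) hPφ (R.qual_dom hφ)
    · rw [Qual.subst_singleton_ne hyx, Qual.subst_of_notMem (q := ∅) (by simp)]
      have hm' : (y, S, q) ∈ Γ := by
        rcases List.mem_append.1 hm with hm | hm
        · exact hm
        · simp at hm
          exact absurd hm.1 hyx
      exact .var (List.mem_append_left _ (List.mem_map.2 ⟨_, hm', rfl⟩))
        (Qual.mem_subst.2 (.inl ⟨hy, by simpa using hyx⟩))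
  | @loc Γ' Ψ φ l S q hm hl =>
    rw [((R.wf.simple hm).scoped ∅ 0).subst_eq (by simp),
      Qual.subst_of_notMem (q := {Atom.loc l}) (by simp),
      Qual.subst_of_notMem (q := ∅) (by simp)]
    exact .loc hm (Qual.mem_subst.2 (.inl ⟨hl, by simp⟩))
  | @abs Γ' Ψ φ t S U p q r ε L hS hp _ hq ih =>
    subst hΓ
    rw [Qual.subst_of_notMem (q := ∅) (by simp)]
    refine .abs (insert x L) (hS.subst R.subset fun _ => Replaces.mem_dom) (R.qual_dom hp)
      (fun y hy => ?_) (Qual.subst_mono hq)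
    rw [Finset.mem_insert, not_or] at hy
    have := ih y hy.2 (Γ := (y, S, p) :: Γ) rfl (by simp_all [names, eq_comm]) R (wf.cons hS hp)
      (union_singleton_subset_dom_cons (hq.trans hφ))
      (hP' (Γ := Γ) R ((Finset.inter_subset_inter_left hq).trans hP) hy.1)
    rwa [Term.subst_named R.typed.lc hy.1, Ty.subst_inst R.bvar_notMem,
      Qual.subst_inst R.bvar_notMem, Qual.subst_inst R.bvar_notMem, Qual.subst_union,
      Qual.subst_singleton_ne hy.1] at this
  | @app Γ' Ψ φ t₁ t₂ S U p q r ε₁ ε₂ ε₃ h1 h2 hp hq hU hε hr ih1 ih2 =>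
    subst hΓ
    rw [Ty.subst_inst R.bvar_notMem, Qual.subst_inst R.bvar_notMem, Qual.subst_union,
      Qual.subst_union, Qual.subst_inst R.bvar_notMem]
    have hU' := ((h1.regular wf hφ).1.2.2.2.1.notFree hU).subst (D' := dom _ Ψ)
      (R.subset (Γ := Γ)) fun _ => Replaces.mem_dom
    exact .app_of_subset (R.target_wf wf) (R.qual_dom hφ) (ih1 rfl hx R wf hφ hP)
      (ih2 rfl hx R wf hφ hP) (R.inter_subset hx hp hq hP)
      ((R.sat_subset hx).trans (Qual.subst_mono hp)) ((R.sat_subset hx).trans (Qual.subst_mono hq))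
      (hU'.isNotFree bvar_notMem_dom le_rfl) (subset_union_bvar_subst hε)
      (subset_union_bvar_subst hr)
  | @letin Γ' Ψ φ t₁ t₂ S U p q ε₁ ε₂ L h1 h2 hU ih1 ih2 =>
    subst hΓ
    rw [Ty.subst_inst R.bvar_notMem, Qual.subst_inst R.bvar_notMem, Qual.subst_union,
      Qual.subst_inst R.bvar_notMem]
    obtain ⟨hS, hp, _⟩ := h1.regular wf hφ
    have hsat := (Finset.inter_subset_right (s₁ := sat (Γ ++ [(x, T, p₀)]) Ψ p)).trans
      (wf.sat_subset_dom hφ)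
    have hU1 : U.Scoped (dom (Γ ++ [(x, T, p₀)]) Ψ) 1 := .of_named L fun y hy =>
      ((h2 y hy).regular (wf.cons hS hsat) (union_singleton_subset_dom_cons hφ)).1.mono
        dom_cons.subset le_rfl
    have hU' := (hU1.notFree hU).subst (D' := dom _ Ψ) (R.subset (Γ := Γ))
      fun _ => Replaces.mem_dom
    refine .letin_of_subset (R.target_wf wf) (R.qual_dom hφ) (insert x L) (ih1 rfl hx R wf hφ hP)
      ((R.sat_subset hx).trans (Qual.subst_mono (Finset.subset_inter subset_rfl (sat_mono hp))))
      (R.qual_dom hsat) (fun y hy => ?_) (hU'.isNotFree bvar_notMem_dom le_rfl)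
    rw [Finset.mem_insert, not_or] at hy
    have := ih2 y hy.2 (Γ := (y, S, _) :: Γ) rfl (by simp_all [names, eq_comm]) R
      (wf.cons hS hsat) (union_singleton_subset_dom_cons hφ) (hP' (Γ := Γ) R hP hy.1)
    rwa [Term.subst_named R.typed.lc hy.1, Ty.subst_inst R.bvar_notMem,
      Qual.subst_inst R.bvar_notMem, Qual.subst_inst R.bvar_notMem, Qual.subst_union,
      Qual.subst_singleton_ne hy.1] at this
  | ref _ _ ih1 ih2 =>
    simpa only [Qual.subst_union] using .ref (ih1 hΓ hx R wf hφ hP) (ih2 hΓ hx R wf hφ hP)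
  | deref _ ih =>
    simpa only [Qual.subst_union] using .deref (ih hΓ hx R wf hφ hP)
  | assign _ _ ih1 ih2 =>
    simpa only [Qual.subst_union] using .assign (ih1 hΓ hx R wf hφ hP) (ih2 hΓ hx R wf hφ hP)
  | @sub Γ' Ψ φ t _ _ _ _ _ _ _ hs hq hε ih =>
    subst hΓ
    have hmem := @Replaces.mem_dom K Γt Γ Ψ x T p₀ P
    exact .sub (ih rfl hx R wf hφ hP) ⟨hs.1.subst R.subset fun _ => hmem,
      hs.2.1.subst R.subset fun _ => hmem, hs.2.2.subst R.subset fun _ => hmem⟩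
      (Qual.subst_mono hq) (Qual.subst_mono hε)

end Replaces

/-! ### Erasure of qualifiers of base types

A term of base type needs no atoms of function or reference type in its qualifier.  Erasure removes
such atoms from all qualifiers of base types in a typing derivation. -/

/-- The type is a base type. -/
def Ty.isBase : Ty K → Bool
  | .base _ => true
  | _ => false

@[simp] theorem Ty.isBase_inst {k : ℕ} {p : Qual} {T : Ty K} :
    (T.inst k p).isBase = T.isBase := by
  cases T <;> rfl

theorem TSub.isBase_eq {Γ : Ctx K} {Ψ : StoreTy K} {S T : Ty K} (h : TSub Γ Ψ S T) :
    S.isBase = T.isBase := by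
  cases h <;> rfl

/-- The atoms to erase under a binder of type `T`. -/
def lift (D : Atom → Bool) (T : Ty K) : Atom → Bool
  | .bvar 0 => !T.isBase
  | .bvar (i + 1) => D (.bvar i)
  | a => D a

/-- Erasure of the atoms in `D` from the qualifier of the type `T`. -/
def eraseQ (D : Atom → Bool) (T : Ty K) (q : Qual) : Qual :=
  if T.isBase then q.filter (fun a => D a = false) else q

/-- Erasure of the atoms in `D` from the qualifiers of base types. -/
def Ty.erase (D : Atom → Bool) : Ty K → Ty K
  | .base B => .base B
  | .fn T q ε U r =>
      .fn (T.erase D) (eraseQ D T q) ε (U.erase (lift D T)) (eraseQ (lift D T) U r)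
  | .ref B => .ref B

/-- Erasure in typing environments. -/
def eraseCtx (D : Atom → Bool) (Γ : Ctx K) : Ctx K :=
  Γ.map fun e => (e.1, e.2.1.erase D, eraseQ D e.2.1 e.2.2)

section Erase

variable {D D' : Atom → Bool} {T : Ty K} {q : Qual}

theorem mem_eraseQ {a : Atom} :
    a ∈ eraseQ D T q ↔ a ∈ q ∧ (T.isBase = true → D a = false) := by
  unfold eraseQ
  split_ifs with h <;> simp [h]

theorem eraseQ_subset : eraseQ D T q ⊆ q := fun _ h => (mem_eraseQ.1 h).1

theorem eraseQ_mono {S : Ty K} {p : Qual} (hS : S.isBase = T.isBase) (h : p ⊆ q) :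
    eraseQ D S p ⊆ eraseQ D T q := by
  intro a
  simp only [mem_eraseQ, hS]
  exact fun ha => ⟨h ha.1, ha.2⟩

theorem Ty.Simple.erase_eq (h : T.Simple) : T.erase D = T := by
  cases T
  · rfl
  · exact h.elim
  · rfl

theorem domC_eraseCtx {Γ : Ctx K} : domC (eraseCtx D Γ) = domC Γ := by
  simp [domC, eraseCtx, Function.comp_def]

theorem dom_eraseCtx {Γ : Ctx K} {Ψ : StoreTy K} : dom (eraseCtx D Γ) Ψ = dom Γ Ψ := by
  rw [dom, domC_eraseCtx]

theorem Qual.Scoped.subset {E p : Qual} {k : ℕ} (h : Qual.Scoped E k q) (hp : p ⊆ q) :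
    Qual.Scoped E k p := fun a ha => h a (hp ha)

theorem Ty.Scoped.erase {E : Qual} {k : ℕ} (h : T.Scoped E k) : (T.erase D).Scoped E k := by
  induction T generalizing k D with
  | fn T q ε U r ihT ihU =>
    obtain ⟨h1, h2, h3, h4, h5⟩ := h
    exact ⟨ihT h1, h2.subset eraseQ_subset, h3, ihU h4, h5.subset eraseQ_subset⟩
  | _ => trivial

/-- `D` and `D'` agree on `E` and on the first `k` bound variables. -/
def Agree (E : Qual) (k : ℕ) (D D' : Atom → Bool) : Prop :=
  (∀ a ∈ E, D a = D' a) ∧ ∀ i < k, D (.bvar i) = D' (.bvar i)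

theorem lift_of_forall_ne {a : Atom} (h : ∀ i, a ≠ .bvar i) : lift D T a = D a := by
  cases a with
  | bvar i => exact absurd rfl (h i)
  | _ => rfl

theorem Agree.lift {E : Qual} {k : ℕ} (hE : ∀ i, Atom.bvar i ∉ E) (h : Agree E k D D') :
    Agree E (k + 1) (lift D T) (lift D' T) := by
  refine ⟨fun a ha => ?_, fun i hi => ?_⟩
  · have : ∀ i, a ≠ .bvar i := fun i hi => hE i (hi ▸ ha)
    rw [lift_of_forall_ne this, lift_of_forall_ne this, h.1 a ha]
  · cases i with
    | zero => rfl
    | succ i => exact h.2 i (by omega)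

theorem Agree.eraseQ {E : Qual} {k : ℕ} (h : Agree E k D D') (hq : Qual.Scoped E k q) :
    eraseQ D T q = eraseQ D' T q := by
  ext a
  simp only [mem_eraseQ]
  refine and_congr_right fun ha => ?_
  have : D a = D' a := by
    rcases hq a ha with ha | ⟨i, hi, rfl⟩
    · exact h.1 a ha
    · exact h.2 i hi
  rw [this]

theorem Agree.erase {E : Qual} {k : ℕ} (hE : ∀ i, Atom.bvar i ∉ E) (h : Agree E k D D')
    (hT : T.Scoped E k) : T.erase D = T.erase D' := by
  induction T generalizing k D D' with
  | fn T q ε U r ihT ihU =>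
    obtain ⟨h1, h2, h3, h4, h5⟩ := hT
    simp only [Ty.erase, ihT h h1, h.eraseQ h2, ihU (h.lift hE) h4, (h.lift hE).eraseQ h5]
  | _ => rfl

/-- `D` and `D'` agree but for the bound variable `k` of `D`, which is `a` in `D'`. -/
def Opens (k : ℕ) (a : Atom) (D D' : Atom → Bool) : Prop :=
  D (.bvar k) = D' a ∧ ∀ b, b ≠ .bvar k → D b = D' b

theorem Opens.lift {k x : ℕ} {p : Qual} (h : Opens k (.fvar x) D D') :
    Opens (k + 1) (.fvar x) (lift D T) (lift D' (T.inst k p)) := by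
  refine ⟨h.1, fun b hb => ?_⟩
  cases b with
  | bvar i =>
    cases i with
    | zero => simp [LStar.lift]
    | succ i => exact h.2 _ (by simpa using hb)
  | _ => exact h.2 _ (by simp)

theorem Opens.eraseQ {k : ℕ} {a : Atom} {p : Qual} (h : Opens k a D D') :
    eraseQ D' (T.inst k p) (Qual.inst k {a} q) = Qual.inst k {a} (eraseQ D T q) := by
  ext b
  simp only [mem_eraseQ, Qual.mem_inst, Ty.isBase_inst, Finset.mem_singleton]
  have h1 := h.1
  have h2 := h.2 b
  grind

theorem Opens.erase {k x : ℕ} (h : Opens k (.fvar x) D D') :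
    (T.inst k {.fvar x}).erase D' = (T.erase D).inst k {.fvar x} := by
  induction T generalizing k D D' with
  | fn T q ε U r ihT ihU =>
    simp only [Ty.erase, Ty.inst, ihT h, ihU h.lift, h.eraseQ, (Opens.lift h).eraseQ]
  | _ => rfl

/-- `D` extended to the variable `x : T`. -/
def bind (D : Atom → Bool) (x : ℕ) (T : Ty K) : Atom → Bool :=
  Function.update D (.fvar x) (!T.isBase)

theorem agree_bind {E : Qual} {k x : ℕ} (hx : Atom.fvar x ∉ E) : Agree E k (bind D x T) D := by
  refine ⟨fun a ha => Function.update_of_ne ?_ _ _, fun i _ => Function.update_of_ne (by simp) _ _⟩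
  rintro rfl
  exact hx ha

theorem opens_bind {x : ℕ} (hD : ∀ i, D (.bvar i) = false) :
    Opens 0 (.fvar x) (lift (bind D x T) T) (bind D x T) := by
  refine ⟨by simp [lift, bind], fun b hb => ?_⟩
  cases b with
  | bvar i =>
    cases i with
    | zero => exact absurd rfl hb
    | succ i => simp [lift, bind, hD]
  | _ => rfl

theorem erase_named {E : Qual} {x : ℕ} {U : Ty K} (hD : ∀ i, D (.bvar i) = false)
    (hE : ∀ i, Atom.bvar i ∉ E) (hx : Atom.fvar x ∉ E) (hU : U.Scoped E 1) :
    (U.named x).erase (bind D x T) = (U.erase (lift D T)).named x := by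
  rw [(opens_bind hD).erase, ((agree_bind hx (k := 0)).lift hE).erase hE hU]

theorem eraseQ_named {E : Qual} {x : ℕ} {U : Ty K} (hD : ∀ i, D (.bvar i) = false)
    (hE : ∀ i, Atom.bvar i ∉ E) (hx : Atom.fvar x ∉ E) (hq : Qual.Scoped E 1 q) :
    eraseQ (bind D x T) (U.named x) (q.named x) = (eraseQ (lift D T) U q).named x := by
  rw [(opens_bind hD).eraseQ, ((agree_bind hx (k := 0)).lift hE).eraseQ hq]

theorem bind_bvar {x : ℕ} (hD : ∀ i, D (.bvar i) = false) (i : ℕ) :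
    bind D x T (.bvar i) = false := by
  simp [bind, hD]

theorem TSub.erase {Γ : Ctx K} {Ψ : StoreTy K} {S T : Ty K} (h : TSub Γ Ψ S T)
    (hD : ∀ i, D (.bvar i) = false) : TSub Γ Ψ (S.erase D) (T.erase D) := by
  induction h generalizing D with
  | base => exact .base _
  | ref => exact .ref _
  | @fn Γ Ψ S T U V o p q r ε₁ ε₂ L h1 h2 h3 h4 h5 ih1 ih3 =>
    obtain ⟨⟨_, _, _, hT, hq⟩, ⟨_, _, _, hV, hr⟩⟩ := (TSub.fn L h1 h2 h3 h4 h5).scoped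
    have hl : lift D S = lift D U := by
      funext a
      unfold lift
      rw [h1.isBase_eq]
    simp only [Ty.erase, hl]
    refine .fn (L ∪ names Γ) (ih1 hD) ⟨eraseQ_mono h1.isBase_eq h2.1, eraseQ_subset.trans h2.2⟩
      (fun x hx => ?_) (fun x hx => ?_) (fun x hx => ?_) <;>
      rw [Finset.mem_union, not_or] at hx
    · have hx' : Atom.fvar x ∉ dom Γ Ψ := fun h => hx.2 (fvar_mem_dom.1 h)
      have := (ih3 x hx.1 (bind_bvar hD) (D := bind D x U)).mono
        (dom_cons_subset (e' := (U.erase D, eraseQ D U p)) subset_rfl)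
      rwa [erase_named hD bvar_notMem_dom hx' hT, erase_named hD bvar_notMem_dom hx' hV] at this
    · have hx' : Atom.fvar x ∉ dom Γ Ψ := fun h => hx.2 (fvar_mem_dom.1 h)
      rw [← eraseQ_named hD bvar_notMem_dom hx' hq, ← eraseQ_named hD bvar_notMem_dom hx' hr]
      refine QSub.mono (Γ := (x, U, p) :: Γ) (Ψ := Ψ) (dom_cons_subset subset_rfl)
        ⟨eraseQ_mono (h3 x hx.1).isBase_eq (h4 x hx.1).1, eraseQ_subset.trans (h4 x hx.1).2⟩
    · exact (h5 x hx.1).mono (dom_cons_subset subset_rfl)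

/-- `D` contains the variables of function or reference type, but no variables or locations of base
type. -/
structure Erasable (D : Atom → Bool) (Γ : Ctx K) (Ψ : StoreTy K) : Prop where
  bvar (i : ℕ) : D (.bvar i) = false
  var {x : ℕ} {T : Ty K} {q : Qual} : (x, T, q) ∈ Γ → D (.fvar x) = !T.isBase
  loc {l : ℕ} {T : Ty K} {q : Qual} : (l, T, q) ∈ Ψ → T.isBase = true → D (.loc l) = false

variable {Γ : Ctx K} {Ψ : StoreTy K}

theorem Erasable.cons (h : Erasable D Γ Ψ) {x : ℕ} (hx : x ∉ names Γ) :
    Erasable (bind D x T) ((x, T, q) :: Γ) Ψ := by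
  refine ⟨bind_bvar h.bvar, fun hm => ?_, fun hm hT => by simpa [bind] using h.loc hm hT⟩
  rcases List.mem_cons.1 hm with hm | hm
  · cases hm
    simp [bind]
  · rw [← h.var hm]
    refine Function.update_of_ne ?_ _ _
    rintro ⟨⟩
    exact hx (mem_names.2 ⟨_, hm, rfl⟩)

theorem WF.eraseCtx (wf : WF Γ Ψ) : WF (eraseCtx D Γ) Ψ := by
  refine ⟨fun h => ?_, fun h => ?_, wf.simple, wf.flat⟩
  · obtain ⟨⟨y, S, q⟩, hm, he⟩ := List.mem_map.1 h
    cases he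
    rw [dom_eraseCtx]
    exact (wf.ty hm).erase
  · obtain ⟨⟨y, S, q⟩, hm, he⟩ := List.mem_map.1 h
    cases he
    rw [dom_eraseCtx]
    exact eraseQ_subset.trans (wf.qual hm)

theorem eraseCtx_cons (wf : WF Γ Ψ) {x : ℕ} (hx : x ∉ names Γ) (hT : T.Scoped (dom Γ Ψ) 0)
    (hq : q ⊆ dom Γ Ψ) :
    eraseCtx (bind D x T) ((x, T, q) :: Γ) = (x, T.erase D, eraseQ D T q) :: eraseCtx D Γ := by
  have hA : Agree (dom Γ Ψ) 0 (bind D x T) D := agree_bind fun h => hx (fvar_mem_dom.1 h)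
  simp only [eraseCtx, List.map_cons, hA.erase bvar_notMem_dom hT,
    hA.eraseQ (Qual.scoped_zero.2 hq), List.cons.injEq, true_and]
  refine List.map_congr_left fun ⟨y, S, r⟩ hm => ?_
  simp only [hA.erase bvar_notMem_dom (wf.ty hm), hA.eraseQ (Qual.scoped_zero.2 (wf.qual hm))]

theorem Reach.of_eraseCtx {a b : Atom} (h : Reach (eraseCtx D Γ) Ψ a b) : Reach Γ Ψ a b := by
  cases h with
  | var hm hb =>
    obtain ⟨⟨y, S, q⟩, hm', he⟩ := List.mem_map.1 hm
    cases he
    exact .var hm' (eraseQ_subset hb)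
  | loc hm hb => exact .loc hm hb

theorem sat_eraseCtx_subset : sat (eraseCtx D Γ) Ψ q ⊆ sat Γ Ψ q :=
  sat_subset subset_sat fun _ ha _ h => sat_closed ha h.of_eraseCtx

theorem Erasable.sat_subset (h : Erasable D Γ Ψ) (wf : WF Γ Ψ) :
    sat (LStar.eraseCtx D Γ) Ψ (eraseQ D T q) ⊆ eraseQ D T (sat Γ Ψ q) := by
  cases hT : T.isBase with
  | false =>
    simp only [eraseQ, hT]
    exact sat_eraseCtx_subset
  | true =>
    refine LStar.sat_subset (eraseQ_mono rfl subset_sat) fun a ha b hab => ?_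
    obtain ⟨ha, haD⟩ := mem_eraseQ.1 ha
    refine mem_eraseQ.2 ⟨sat_closed ha hab.of_eraseCtx, fun _ => ?_⟩
    cases hab with
    | var hm hb =>
      obtain ⟨⟨y, S, q⟩, hm', he⟩ := List.mem_map.1 hm
      cases he
      have := h.var hm'
      rw [haD hT] at this
      exact (mem_eraseQ.1 hb).2 (by simpa using this.symm)
    | loc hm hb => simp [wf.flat hm] at hb

theorem inst_eraseQ_subset {U : Ty K} {p r : Qual} (hr : Qual.Scoped (dom Γ Ψ) 1 r) :
    Qual.inst 0 (eraseQ D T p) (eraseQ (lift D T) U r) ⊆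
      eraseQ D (U.inst 0 p) (Qual.inst 0 p r) := by
  intro a ha
  simp only [mem_eraseQ, Qual.mem_inst, Ty.isBase_inst] at ha ⊢
  rcases ha with ⟨⟨h1, h2⟩, h3⟩ | ⟨⟨h1, h2⟩, h3, h4⟩
  · refine ⟨.inl ⟨h1, h3⟩, fun hU => ?_⟩
    rw [← h2 hU, lift_of_forall_ne]
    rintro i rfl
    rcases hr _ h1 with h | ⟨j, hj, h⟩
    · exact bvar_notMem_dom _ h
    · cases h
      obtain rfl : i = 0 := by omega
      exact h3 rfl
  · exact ⟨.inr ⟨h1, h3⟩, fun hU => h4 (by simpa [lift] using h2 hU)⟩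

theorem erase_inst_of_notFree {U : Ty K} {p p' : Qual} (hU : U.Scoped (dom Γ Ψ) 1)
    (hU' : U.NotFree 0) :
    (U.erase (lift D T)).inst 0 p' = (U.inst 0 p).erase D := by
  have h := hU.notFree hU'
  rw [h.inst_eq bvar_notMem_dom le_rfl, h.erase.inst_eq bvar_notMem_dom le_rfl]
  refine Agree.erase bvar_notMem_dom ⟨fun a ha => lift_of_forall_ne ?_, by simp⟩ h
  rintro i rfl
  exact bvar_notMem_dom _ ha

theorem HasType.erase {φ : Qual} {t : Term C} {ε : Qual} (h : HasType Γ Ψ φ t T q ε)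
    (hD : Erasable D Γ Ψ) (wf : WF Γ Ψ) (hφ : φ ⊆ dom Γ Ψ) :
    HasType (eraseCtx D Γ) Ψ φ t (T.erase D) (eraseQ D T q) ε := by
  induction h generalizing D with
  | cst c =>
    have : eraseQ D (Ty.base c.ty) ∅ = ∅ := rfl
    rw [this]
    exact .cst c
  | @var Γ Ψ φ x T q hm hx =>
    have : eraseQ D T {.fvar x} = {.fvar x} := by
      ext a
      have := hD.var hm
      simp only [mem_eraseQ, Finset.mem_singleton]
      grind
    rw [this]
    exact .var (List.mem_map.2 ⟨_, hm, rfl⟩) hx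
  | @loc Γ Ψ φ l T q hm hl =>
    have : eraseQ D T {.loc l} = {.loc l} := by
      ext a
      have := hD.loc hm
      simp only [mem_eraseQ, Finset.mem_singleton]
      grind
    rw [this, (wf.simple hm).erase_eq]
    exact .loc hm hl
  | @abs Γ Ψ φ t T U p q r ε L hT hp h hq ih =>
    obtain ⟨⟨_, _, _, hU, hr⟩, _⟩ := (HasType.abs L hT hp h hq).regular wf hφ
    refine .abs (L ∪ names Γ) (by rw [← dom, dom_eraseCtx]; exact hT.erase)
      (by rw [← dom, dom_eraseCtx]; exact eraseQ_subset.trans hp) (fun x hx => ?_) hq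
    rw [Finset.mem_union, not_or] at hx
    have hx' : Atom.fvar x ∉ dom Γ Ψ := fun h => hx.2 (fvar_mem_dom.1 h)
    have := ih x hx.1 (hD.cons hx.2) (wf.cons hT hp)
      (union_singleton_subset_dom_cons (hq.trans hφ))
    rwa [eraseCtx_cons wf hx.2 hT hp, erase_named hD.bvar bvar_notMem_dom hx' hU,
      eraseQ_named hD.bvar bvar_notMem_dom hx' hr] at this
  | @app Γ Ψ φ t₁ t₂ T U p q r ε₁ ε₂ ε₃ h1 h2 hp hq hU hε hr ih1 ih2 =>
    obtain ⟨⟨_, _, _, hU', hr'⟩, _⟩ := h1.regular wf hφ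
    have hreg := (HasType.app h1 h2 hp hq hU hε hr).regular wf hφ
    have hsat := hD.sat_subset (T := T) (q := p) wf
    have hφ' : φ ⊆ dom (eraseCtx D Γ) Ψ := by rwa [dom_eraseCtx]
    have := HasType.app_of_subset wf.eraseCtx hφ' (ih1 hD wf hφ) (ih2 hD wf hφ)
      (fun a ha => ?_) ((hsat.trans eraseQ_subset).trans hp) (sat_eraseCtx_subset.trans hq)
      ((hU'.notFree hU).erase.isNotFree bvar_notMem_dom le_rfl) hε (eraseQ_subset.trans hr)
    · rw [erase_inst_of_notFree hU' hU (p := p)] at this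
      exact this.up wf.eraseCtx hφ' (inst_eraseQ_subset hr') (eraseQ_subset.trans hreg.2.1)
        (Finset.union_subset_union_right (Qual.inst_mono eraseQ_subset subset_rfl)) hreg.2.2
    · obtain ⟨ha1, ha2⟩ := Finset.mem_inter.1 ha
      have ha1 := mem_eraseQ.1 (hsat ha1)
      exact mem_eraseQ.2 ⟨Finset.mem_inter.2 ⟨ha1.1, sat_eraseCtx_subset ha2⟩, ha1.2⟩
  | @letin Γ Ψ φ t₁ t₂ S T p q ε₁ ε₂ L h1 h2 hT ih1 ih2 =>
    obtain ⟨hS, hp, hε₁⟩ := h1.regular wf hφ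
    have hreg := (HasType.letin L h1 h2 hT).regular wf hφ
    have ho := (Finset.inter_subset_right (s₁ := sat Γ Ψ p)).trans (wf.sat_subset_dom hφ)
    have hb x hx := (h2 x hx).regular (wf.cons hS ho) (union_singleton_subset_dom_cons hφ)
    have hT1 : T.Scoped (dom Γ Ψ) 1 := .of_named L fun x hx =>
      (hb x hx).1.mono dom_cons.subset le_rfl
    have hq1 : Qual.Scoped (dom Γ Ψ) 1 q := .of_named L fun x hx =>
      Qual.scoped_zero.2 ((hb x hx).2.1.trans (union_singleton_subset_insert hφ))
    have hφ' : φ ⊆ dom (eraseCtx D Γ) Ψ := by rwa [dom_eraseCtx]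
    have := HasType.letin_of_subset wf.eraseCtx hφ' (L ∪ names Γ) (ih1 hD wf hφ)
      (o := eraseQ D S (sat Γ Ψ p ∩ sat Γ Ψ φ)) (T := T.erase (lift D S))
      (q := eraseQ (lift D S) T q) (t₂ := t₂) (ε₂ := ε₂)
      ((hD.sat_subset wf).trans
        (eraseQ_mono rfl (Finset.subset_inter subset_rfl (sat_mono hp))))
      (by rw [dom_eraseCtx]; exact eraseQ_subset.trans ho) (fun x hx => ?_)
      ((hT1.notFree hT).erase.isNotFree bvar_notMem_dom le_rfl)
    · rw [erase_inst_of_notFree hT1 hT (p := p)] at this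
      exact this.up wf.eraseCtx hφ' (inst_eraseQ_subset hq1) (eraseQ_subset.trans hreg.2.1)
        (Finset.union_subset_union_right (Qual.inst_mono eraseQ_subset subset_rfl)) hreg.2.2
    · rw [Finset.mem_union, not_or] at hx
      have hx' : Atom.fvar x ∉ dom Γ Ψ := fun h => hx.2 (fvar_mem_dom.1 h)
      have := ih2 x hx.1 (hD.cons hx.2) (wf.cons hS ho) (union_singleton_subset_dom_cons hφ)
      rwa [eraseCtx_cons wf hx.2 hS ho, erase_named hD.bvar bvar_notMem_dom hx' hT1,
        eraseQ_named hD.bvar bvar_notMem_dom hx' hq1] at this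
  | @ref Γ Ψ φ t₁ t₂ B q ε₁ ε₂ h1 h2 ih1 ih2 =>
    refine (HasType.ref (ih1 hD wf hφ) (ih2 hD wf hφ)).up wf.eraseCtx
      (by rwa [dom_eraseCtx]) (by simp) (eraseQ_subset.trans (by simp))
      (Finset.union_subset_union_right eraseQ_subset) ((HasType.ref h1 h2).regular wf hφ).2.2
  | deref _ ih => exact .deref (ih hD wf hφ)
  | assign _ _ ih1 ih2 => exact .assign (ih1 hD wf hφ) (ih2 hD wf hφ)
  | @sub Γ Ψ φ t S T p q ε₁ ε₂ _ hs hq hε ih =>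
    have hd : dom Γ Ψ ⊆ dom (eraseCtx D Γ) Ψ := by rw [dom_eraseCtx]
    exact .sub (ih hD wf hφ) ⟨(hs.1.erase hD.bvar).mono hd,
      ⟨eraseQ_mono hs.1.isBase_eq hs.2.1.1, (eraseQ_subset.trans hs.2.1.2).trans hd⟩,
      hs.2.2.mono hd⟩ (eraseQ_subset.trans hq) hε

end Erase

/-! ### Stores -/

theorem dom_nil {Ψ : StoreTy K} : dom [] Ψ = domS Ψ := by
  simp [dom]

theorem WF.nil {Ψ : StoreTy K} (simple : ∀ e ∈ Ψ, e.2.1.Simple) (flat : ∀ e ∈ Ψ, e.2.2 = ∅) :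
    WF [] Ψ :=
  ⟨fun h => by simp at h, fun h => by simp at h, fun h => simple _ h, fun h => flat _ h⟩

section Store

variable {Γ : Ctx K} {Ψ : StoreTy K} {φ : Qual} {σ : Store C}

theorem StoreOK.simple (h : StoreOK Γ φ Ψ σ) : ∀ e ∈ Ψ, e.2.1.Simple ∧ e.2.2 = ∅ := by
  induction h with
  | empty => simp
  | init w => simp [Ty.Simple]
  | ref _ _ _ _ ih => simpa [Ty.Simple] using ih

theorem StoreOK.wf (h : StoreOK Γ φ Ψ σ) : WF [] Ψ :=
  .nil (fun e he => (h.simple e he).1) (fun e he => (h.simple e he).2)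

theorem StoreOK.map_fst (h : StoreOK Γ φ Ψ σ) : σ.map Prod.fst = Ψ.map Prod.fst := by
  induction h with
  | empty => rfl
  | init w => rfl
  | ref _ _ _ _ ih => simp [ih]

theorem StoreOK.loc_notMem (h : StoreOK Γ φ Ψ σ) {l : ℕ} (hl : l ∉ σ.map Prod.fst) :
    Atom.loc l ∉ domS Ψ := by
  rw [h.map_fst] at hl
  simpa [domS] using hl

theorem StoreOK.unique (h : StoreOK Γ φ Ψ σ) {l : ℕ} {S T : Ty K} {q r : Qual}
    (h1 : (l, S, q) ∈ Ψ) (h2 : (l, T, r) ∈ Ψ) : S = T := by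
  induction h with
  | empty => simp at h1
  | init w => simp_all
  | ref _ _ _ hl ih =>
    rcases List.mem_cons.1 h1 with e1 | g1 <;> rcases List.mem_cons.1 h2 with e2 | g2
    · cases e1
      cases e2
      rfl
    · cases e1
      exact absurd (mem_domS_of_mem g2) hl
    · cases e2
      exact absurd (mem_domS_of_mem g1) hl
    · exact ih g1 g2

/-- The contents of reference cells are constants. -/
theorem StoreOK.lookup (h : StoreOK Γ φ Ψ σ) {l : ℕ} {s : Term C} (hl : (l, Cell.ref s) ∈ σ) :
    ∃ c : Const C, s = .const c ∧ (l, Ty.ref c.ty, ∅) ∈ Ψ := by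
  induction h with
  | empty => simp at hl
  | init w => simp at hl
  | ref _ hs ht _ ih =>
    rcases List.mem_cons.1 hl with hl | hl
    · cases hl
      obtain ⟨c, rfl, rfl⟩ := ht.const_of_value hs
      exact ⟨c, rfl, List.mem_cons_self⟩
    · obtain ⟨c, hc, hm⟩ := ih hl
      exact ⟨c, hc, List.mem_cons_of_mem _ hm⟩

theorem StoreOK.observe (h : StoreOK Γ φ Ψ σ) (φ' : Qual) : StoreOK Γ φ' Ψ σ := by
  induction h with
  | empty => exact .empty
  | init w => exact .init w
  | ref _ hs ht hl ih =>
    obtain ⟨c, rfl, rfl⟩ := ht.const_of_value hs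
    exact .ref ih hs (.cst c) hl

theorem StoreOK.update {σ₁ σ₂ : Store C} {l : ℕ} {c c' : Const C}
    (h : StoreOK Γ φ Ψ (σ₁ ++ (l, .ref (.const c)) :: σ₂)) (hc : c'.ty = c.ty) :
    StoreOK Γ φ Ψ (σ₁ ++ (l, .ref (.const c')) :: σ₂) := by
  generalize hσ : σ₁ ++ (l, Cell.ref (.const c)) :: σ₂ = σ at h
  induction h generalizing σ₁ with
  | empty => simp at hσ
  | init w =>
    cases σ₁ with
    | nil => cases hσ
    | cons e σ₁ => simp at hσ
  | ref h hs ht hl ih =>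
    cases σ₁ with
    | nil =>
      cases hσ
      obtain ⟨d, hd, rfl⟩ := ht.const_of_value hs
      cases hd
      rw [← hc]
      exact .ref h (.const c') (.cst c') hl
    | cons e σ₁ =>
      cases hσ
      exact .ref (ih rfl) hs ht hl

end Store

/-! ### Growing store typings -/

/-- `Ψ'` extends `Ψ`, and `δ` consists of new locations that hold references. -/
structure Grow (Ψ Ψ' : StoreTy K) (δ : Qual) : Prop where
  wf : WF [] Ψ
  wf' : WF [] Ψ'
  subset : Ψ ⊆ Ψ'
  qual_subset : δ ⊆ domS Ψ' \ domS Ψ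
  isBase {l : ℕ} {T : Ty K} {q : Qual} : (l, T, q) ∈ Ψ' → Atom.loc l ∈ δ → T.isBase = false

theorem Grow.refl {Ψ : StoreTy K} (wf : WF [] Ψ) : Grow Ψ Ψ ∅ :=
  ⟨wf, wf, List.Subset.refl _, by simp, by simp⟩

theorem Grow.ref {Ψ : StoreTy K} (wf : WF [] Ψ) {l : ℕ} (hl : Atom.loc l ∉ domS Ψ) (B : Base K) :
    Grow Ψ ((l, .ref B, ∅) :: Ψ) {.loc l} := by
  refine ⟨wf, .nil ?_ ?_, List.subset_cons_self _ _, by simpa using hl, fun hm h => ?_⟩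
  · simp only [List.mem_cons, forall_eq_or_imp]
    exact ⟨trivial, fun e he => wf.simple he⟩
  · simp only [List.mem_cons, forall_eq_or_imp]
    exact ⟨trivial, fun e he => wf.flat he⟩
  · rcases List.mem_cons.1 hm with hm | hm
    · cases hm
      rfl
    · obtain ⟨⟩ := Finset.mem_singleton.1 h
      exact absurd (mem_domS_of_mem hm) hl

section Grow

variable {Ψ Ψ' : StoreTy K} {δ : Qual}

theorem Grow.ext (g : Grow Ψ Ψ' δ) : Ext [] Ψ [] Ψ' := by
  refine ⟨fun h => by simp at h, fun h => ⟨_, g.subset h⟩, fun _ h => ?_⟩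
  cases h with
  | var hm => simp at hm
  | loc hm hb => simp [g.wf'.flat hm] at hb

theorem Grow.dom_subset (g : Grow Ψ Ψ' δ) : domS Ψ ⊆ domS Ψ' := by
  simpa only [dom_nil] using g.ext.dom_subset

theorem Grow.subset' (g : Grow Ψ Ψ' δ) : δ ⊆ domS Ψ' :=
  g.qual_subset.trans Finset.sdiff_subset

theorem Grow.union_subset (g : Grow Ψ Ψ' δ) {q : Qual} (hq : q ⊆ domS Ψ) : q ∪ δ ⊆ domS Ψ' :=
  Finset.union_subset (hq.trans g.dom_subset) g.subset'

theorem Grow.bvar_notMem (g : Grow Ψ Ψ' δ) (i : ℕ) : Atom.bvar i ∉ δ := fun h =>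
  bvar_notMem_dom (Γ := []) i (dom_nil.superset (g.subset' h))

theorem Grow.fvar_notMem (g : Grow Ψ Ψ' δ) (x : ℕ) : Atom.fvar x ∉ δ := fun h =>
  fvar_notMem_domS (g.subset' h)

theorem Grow.notMem (g : Grow Ψ Ψ' δ) {a : Atom} (h : a ∈ δ) : a ∉ domS Ψ :=
  (Finset.mem_sdiff.1 (g.qual_subset h)).2

theorem HasType.regular_nil {t : Term C} {T : Ty K} {q ε : Qual}
    (h : HasType [] Ψ (domS Ψ) t T q ε) (wf : WF [] Ψ) :
    T.Scoped (domS Ψ) 0 ∧ q ⊆ domS Ψ ∧ ε ⊆ domS Ψ := by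
  simpa only [dom_nil] using h.regular wf dom_nil.superset

theorem Grow.weaken (g : Grow Ψ Ψ' δ) {t : Term C} {T : Ty K} {q ε : Qual}
    (h : HasType [] Ψ (domS Ψ) t T q ε) : HasType [] Ψ' (domS Ψ') t T q ε :=
  h.weaken g.wf dom_nil.superset g.ext g.wf' g.dom_subset dom_nil.superset

theorem Grow.erase (g : Grow Ψ Ψ' δ) {t : Term C} {B : Base K} {ε : Qual}
    (h : HasType [] Ψ' (domS Ψ') t (.base B) (∅ ∪ δ) ε) :
    HasType [] Ψ' (domS Ψ') t (.base B) ∅ ε := by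
  have := h.erase (D := fun a => decide (a ∈ δ)) ⟨fun i => by simpa using g.bvar_notMem i,
    fun h => by simp at h, fun {l T q} hm hT => ?_⟩ g.wf' dom_nil.superset
  · have he : eraseQ (fun a => decide (a ∈ δ)) (.base B : Ty K) (∅ ∪ δ) = ∅ := by
      ext a
      simp [mem_eraseQ, Ty.isBase]
    rwa [he] at this
  · rw [decide_eq_false_iff_not]
    intro hl
    rw [g.isBase hm hl] at hT
    cases hT

theorem Qual.inst_union_subset {k : ℕ} {p δ q : Qual} :
    Qual.inst k (p ∪ δ) q ⊆ Qual.inst k p q ∪ δ := by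
  intro a
  simp only [Qual.mem_inst, Finset.mem_union]
  tauto

theorem Grow.appL (g : Grow Ψ Ψ' δ) {t₁ t₁' t₂ : Term C} {T U : Ty K}
    {p q r ε₁ ε₂ ε₃ : Qual}
    (h1 : HasType [] Ψ (domS Ψ) t₁ (.fn T (sat [] Ψ p ∩ sat [] Ψ q) ε₃ U r) q ε₁)
    (h2 : HasType [] Ψ (domS Ψ) t₂ T p ε₂)
    (hU : U.NotFree 0) (hε : ε₃ ⊆ q ∪ {.bvar 0}) (hr : r ⊆ domS Ψ ∪ {.bvar 0})
    (h : HasType [] Ψ (domS Ψ) (.app t₁ t₂) (U.inst 0 p) (Qual.inst 0 p r)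
      (ε₁ ∪ ε₂ ∪ Qual.inst 0 p ε₃))
    (h1' : HasType [] Ψ' (domS Ψ') t₁' (.fn T (sat [] Ψ p ∩ sat [] Ψ q) ε₃ U r) (q ∪ δ)
      (ε₁ ∪ δ)) :
    HasType [] Ψ' (domS Ψ') (.app t₁' t₂) (U.inst 0 p) (Qual.inst 0 p r ∪ δ)
      (ε₁ ∪ ε₂ ∪ Qual.inst 0 p ε₃ ∪ δ) := by
  obtain ⟨_, hq, _⟩ := h1.regular_nil g.wf
  obtain ⟨_, hp, _⟩ := h2.regular_nil g.wf
  obtain ⟨_, hreg, hreg'⟩ := h.regular_nil g.wf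
  refine (HasType.app_of_subset g.wf' dom_nil.superset h1' (g.weaken h2) ?_ ?_ ?_ hU
    (hε.trans (Finset.union_subset_union_left Finset.subset_union_left))
    (hr.trans (Finset.union_subset_union_left g.dom_subset))).up g.wf' dom_nil.superset
    Finset.subset_union_left (g.union_subset hreg) ?_ (g.union_subset hreg')
  · rw [g.wf.sat_nil, g.wf.sat_nil, g.wf'.sat_nil, g.wf'.sat_nil]
    intro a ha
    have := g.notMem (a := a)
    have := @hp a
    grind
  · rw [g.wf'.sat_nil]
    exact hp.trans g.dom_subset
  · rw [g.wf'.sat_nil]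
    exact g.union_subset hq
  · grind

theorem Grow.appR (g : Grow Ψ Ψ' δ) {t₁ t₂ t₂' : Term C} {T U : Ty K}
    {p q r ε₁ ε₂ ε₃ : Qual}
    (h1 : HasType [] Ψ (domS Ψ) t₁ (.fn T (sat [] Ψ p ∩ sat [] Ψ q) ε₃ U r) q ε₁)
    (h2 : HasType [] Ψ (domS Ψ) t₂ T p ε₂)
    (hU : U.NotFree 0) (hε : ε₃ ⊆ q ∪ {.bvar 0}) (hr : r ⊆ domS Ψ ∪ {.bvar 0})
    (h : HasType [] Ψ (domS Ψ) (.app t₁ t₂) (U.inst 0 p) (Qual.inst 0 p r)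
      (ε₁ ∪ ε₂ ∪ Qual.inst 0 p ε₃))
    (h2' : HasType [] Ψ' (domS Ψ') t₂' T (p ∪ δ) (ε₂ ∪ δ)) :
    HasType [] Ψ' (domS Ψ') (.app t₁ t₂') (U.inst 0 p) (Qual.inst 0 p r ∪ δ)
      (ε₁ ∪ ε₂ ∪ Qual.inst 0 p ε₃ ∪ δ) := by
  obtain ⟨⟨_, _, _, hU', _⟩, hq, _⟩ := h1.regular_nil g.wf
  obtain ⟨_, hp, _⟩ := h2.regular_nil g.wf
  obtain ⟨_, hreg, hreg'⟩ := h.regular_nil g.wf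
  have hU0 := (hU'.notFree hU).mono dom_nil.superset le_rfl
  have hUp : U.inst 0 p = U.inst 0 (p ∪ δ) := by
    rw [hU0.inst_eq bvar_notMem_dom le_rfl, hU0.inst_eq bvar_notMem_dom le_rfl]
  rw [hUp]
  refine (HasType.app_of_subset g.wf' dom_nil.superset (g.weaken h1) h2' ?_ ?_ ?_ hU hε
    (hr.trans (Finset.union_subset_union_left g.dom_subset))).up g.wf' dom_nil.superset
    Qual.inst_union_subset (g.union_subset hreg) ?_ (g.union_subset hreg')
  · rw [g.wf.sat_nil, g.wf.sat_nil, g.wf'.sat_nil, g.wf'.sat_nil]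
    intro a ha
    have := g.notMem (a := a)
    have := @hq a
    grind
  · rw [g.wf'.sat_nil]
    exact g.union_subset hp
  · rw [g.wf'.sat_nil]
    exact hq.trans g.dom_subset
  · have := @Qual.inst_union_subset 0 p δ ε₃
    intro a
    have := @this a
    grind

theorem Grow.subst_named (g : Grow Ψ Ψ' δ) {x : ℕ} {q : Qual}
    (hq : Qual.Scoped (domS Ψ) 1 q) :
    Qual.subst x ({.fvar x} ∪ δ) (q.named x) =
      (Qual.inst 0 ({.bvar 0} ∪ δ) q).named x := by
  have hx : Atom.fvar x ∉ q := by
    intro h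
    rcases hq _ h with h | ⟨i, _, h⟩
    · exact fvar_notMem_domS h
    · cases h
  ext a
  have h1 := g.bvar_notMem 0
  have h2 := g.fvar_notMem x
  simp only [Qual.mem_subst, Qual.mem_inst, Finset.mem_union, Finset.mem_singleton]
  grind

theorem Grow.inst_subset (g : Grow Ψ Ψ' δ) {p q : Qual} :
    Qual.inst 0 (p ∪ δ) (Qual.inst 0 ({.bvar 0} ∪ δ) q) ⊆ Qual.inst 0 p q ∪ δ := by
  intro a
  have h1 := g.bvar_notMem 0
  simp only [Qual.mem_inst, Finset.mem_union, Finset.mem_singleton]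
  grind

theorem Grow.letin (g : Grow Ψ Ψ' δ) {t₁ t₁' t₂ : Term C} {S T : Ty K} {p q ε₁ ε₂ : Qual}
    (L : Finset ℕ) (h1 : HasType [] Ψ (domS Ψ) t₁ S p ε₁)
    (h2 : ∀ x ∉ L, HasType [(x, S, sat [] Ψ p ∩ sat [] Ψ (domS Ψ))] Ψ (domS Ψ ∪ {.fvar x})
      (t₂.named x) (T.named x) (q.named x) (ε₂.named x))
    (hT : T.NotFree 0)
    (h1' : HasType [] Ψ' (domS Ψ') t₁' S (p ∪ δ) (ε₁ ∪ δ)) :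
    HasType [] Ψ' (domS Ψ') (.letin t₁' t₂) (T.inst 0 p) (Qual.inst 0 p q ∪ δ)
      (ε₁ ∪ Qual.inst 0 p ε₂ ∪ δ) := by
  obtain ⟨_, hreg, hreg'⟩ := (HasType.letin L h1 h2 hT).regular_nil g.wf
  obtain ⟨hS, hp, _⟩ := h1.regular_nil g.wf
  have hpe : sat [] Ψ p ∩ sat [] Ψ (domS Ψ) = p := by
    rw [g.wf.sat_nil, g.wf.sat_nil, Finset.inter_eq_left]
    exact hp
  rw [hpe] at h2
  have wfx x : WF [(x, S, p)] Ψ :=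
    g.wf.cons (hS.mono dom_nil.superset le_rfl) (hp.trans dom_nil.superset)
  have hφx x : domS Ψ ∪ {.fvar x} ⊆ dom [(x, S, p)] Ψ :=
    union_singleton_subset_dom_cons dom_nil.superset
  have hT1 : T.Scoped (domS Ψ) 1 := .of_named L fun x hx =>
    ((h2 x hx).regular (wfx x) (hφx x)).1.mono (by rw [dom_cons, dom_nil]) le_rfl
  have hq1 : Qual.Scoped (domS Ψ) 1 q := .of_named L fun x hx =>
    Qual.scoped_zero.2 (((h2 x hx).regular (wfx x) (hφx x)).2.1.trans
      (union_singleton_subset_insert subset_rfl))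
  have hε1 : Qual.Scoped (domS Ψ) 1 ε₂ := .of_named L fun x hx =>
    Qual.scoped_zero.2 (((h2 x hx).regular (wfx x) (hφx x)).2.2.trans
      (union_singleton_subset_insert subset_rfl))
  have hT0 := (hT1.notFree hT).mono dom_nil.superset le_rfl
  have hTp : T.inst 0 p = T.inst 0 (p ∪ δ) := by
    rw [hT0.inst_eq bvar_notMem_dom le_rfl, hT0.inst_eq bvar_notMem_dom le_rfl]
  have hS' := hS.mono g.dom_subset le_rfl
  have hpδ := (g.union_subset hp).trans (dom_nil (K := K)).superset
  have wfx' x : WF [(x, S, p ∪ δ)] Ψ' := g.wf'.cons (hS'.mono dom_nil.superset le_rfl) hpδ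
  rw [hTp]
  have hsat : sat [] Ψ' (p ∪ δ) ⊆ p ∪ δ := by rw [g.wf'.sat_nil]
  have hbody : ∀ x ∉ L, HasType [(x, S, p ∪ δ)] Ψ' (domS Ψ' ∪ {.fvar x}) (t₂.named x) (T.named x)
      ((Qual.inst 0 ({.bvar 0} ∪ δ) q).named x) ((Qual.inst 0 ({.bvar 0} ∪ δ) ε₂).named x) := by
    intro x hx
    have hP : {.fvar x} ∪ δ ⊆ dom [(x, S, p ∪ δ)] Ψ' := by
      rw [dom_cons, dom_nil, Finset.union_comm]
      exact union_singleton_subset_insert g.subset'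
    have R : Replaces [(x, S, p ∪ δ)] Ψ' x S p ({.fvar x} ∪ δ) (.fvar x : Term C) := by
      refine ⟨wfx' x, by simp [names], ?_, hP, hS', hp.trans g.dom_subset, fun ha h => ?_⟩
      · exact (HasType.var List.mem_cons_self (by simp)).up (wfx' x) hP Finset.subset_union_left
          subset_rfl subset_rfl (by simp)
      · cases h with
        | var hm hb =>
          simp only [List.mem_singleton, Prod.mk.injEq] at hm
          obtain ⟨rfl, rfl, rfl⟩ := hm
          grind
        | loc hm hb => simp [g.wf'.flat hm] at hb
    have wfp : WF [(x, S, p)] Ψ' := g.wf'.cons (hS'.mono dom_nil.superset le_rfl)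
      ((hp.trans g.dom_subset).trans dom_nil.superset)
    have hφ' : domS Ψ ∪ {.fvar x} ⊆ dom [(x, S, p)] Ψ' :=
      union_singleton_subset_dom_cons (g.dom_subset.trans dom_nil.superset)
    have hw := (h2 x hx).weaken (wfx x) (hφx x) (g.ext.cons (by simp [names]) subset_rfl) wfp
      subset_rfl hφ'
    have hs := hw.subst_aux (Γ := []) rfl (by simp [names]) R wfp hφ' (fun a ha => by
      have := g.notMem (a := a)
      grind)
    have hTx : (T.named x).subst x ({.fvar x} ∪ δ) = T.named x := by
      rw [Ty.named, hT0.inst_eq bvar_notMem_dom le_rfl,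
        (hT1.notFree hT).subst_eq fvar_notMem_domS]
    rw [Term.subst_self, hTx, g.subst_named hq1, g.subst_named hε1] at hs
    have hobs : Qual.subst x ({.fvar x} ∪ δ) (domS Ψ ∪ {.fvar x}) ⊆ domS Ψ' ∪ {.fvar x} := by
      intro a
      have h1 (h : a ∈ δ) := g.subset' h
      have h2 (h : a ∈ domS Ψ) := g.dom_subset h
      simp only [Qual.mem_subst, Finset.mem_union, Finset.mem_singleton]
      grind
    have hdom : domS Ψ' ∪ {.fvar x} ⊆ dom [(x, S, p ∪ δ)] Ψ' :=
      union_singleton_subset_dom_cons dom_nil.superset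
    exact hs.weaken (wfx' x) (hobs.trans hdom) .rfl (wfx' x) hobs hdom
  have key := HasType.letin_of_subset g.wf' dom_nil.superset L h1' hsat hpδ hbody hT
  refine key.up g.wf' dom_nil.superset g.inst_subset (g.union_subset hreg) ?_
    (g.union_subset hreg')
  have := g.inst_subset (p := p) (q := ε₂)
  intro a
  have := @this a
  grind

/-- Typing of a plugged evaluation context yields a typing of the term in its hole, and that term
can be replaced in any larger store typing. -/
theorem HasType.plug {Γ : Ctx K} {φ : Qual} {t : Term C} {T : Ty K} {q ε : Qual}
    (h : HasType Γ Ψ φ t T q ε) (hΓ : Γ = []) (hφ : φ = domS Ψ) (wf : WF [] Ψ) (E : ECtx C)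
    (a : Term C) (ht : t = E.plug a) :
    ∃ (S : Ty K) (p ε₀ : Qual), HasType [] Ψ (domS Ψ) a S p ε₀ ∧
      ∀ (Ψ' : StoreTy K) (δ : Qual) (b : Term C), Grow Ψ Ψ' δ →
        HasType [] Ψ' (domS Ψ') b S (p ∪ δ) (ε₀ ∪ δ) →
        HasType [] Ψ' (domS Ψ') (E.plug b) T (q ∪ δ) (ε ∪ δ) := by
  have hole {Ψ : StoreTy K} {a : Term C} {T : Ty K} {q ε : Qual}
      (h : HasType [] Ψ (domS Ψ) a T q ε) :
      ∃ (S : Ty K) (p ε₀ : Qual), HasType [] Ψ (domS Ψ) a S p ε₀ ∧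
      ∀ (Ψ' : StoreTy K) (δ : Qual) (b : Term C), Grow Ψ Ψ' δ →
        HasType [] Ψ' (domS Ψ') b S (p ∪ δ) (ε₀ ∪ δ) →
        HasType [] Ψ' (domS Ψ') (ECtx.hole.plug b) T (q ∪ δ) (ε ∪ δ) :=
    ⟨T, q, ε, h, fun _ _ _ _ h => h⟩
  induction h generalizing E with
  | cst c =>
    subst hΓ hφ
    cases E <;> cases ht
    exact hole (.cst c)
  | var hm hx =>
    subst hΓ hφ
    cases E <;> cases ht
    exact hole (.var hm hx)
  | loc hm hl =>
    subst hΓ hφ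
    cases E <;> cases ht
    exact hole (.loc hm hl)
  | abs L hT hp h hq _ =>
    subst hΓ hφ
    cases E <;> cases ht
    exact hole (.abs L hT hp h hq)
  | app h1 h2 hp hq hU hε hr ih1 ih2 =>
    subst hΓ hφ
    have h := HasType.app h1 h2 hp hq hU hε hr
    cases E <;> cases ht
    · exact hole h
    · obtain ⟨S, p, ε₀, h0, k⟩ := ih1 rfl rfl wf _ rfl
      exact ⟨S, p, ε₀, h0, fun Ψ' δ b g hb => g.appL h1 h2 hU hε hr h (k Ψ' δ b g hb)⟩
    · obtain ⟨S, p, ε₀, h0, k⟩ := ih2 rfl rfl wf _ rfl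
      exact ⟨S, p, ε₀, h0, fun Ψ' δ b g hb => g.appR h1 h2 hU hε hr h (k Ψ' δ b g hb)⟩
  | letin L h1 h2 hT ih1 _ =>
    subst hΓ hφ
    cases E <;> cases ht
    · exact hole (.letin L h1 h2 hT)
    · obtain ⟨S, p, ε₀, h0, k⟩ := ih1 rfl rfl wf _ rfl
      exact ⟨S, p, ε₀, h0, fun Ψ' δ b g hb => g.letin L h1 h2 hT (k Ψ' δ b g hb)⟩
  | ref h1 h2 ih1 ih2 =>
    subst hΓ hφ
    have hreg := ((HasType.ref h1 h2).regular_nil wf).2.2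
    cases E <;> cases ht
    · exact hole (.ref h1 h2)
    · obtain ⟨S, p, ε₀, h0, k⟩ := ih1 rfl rfl wf _ rfl
      refine ⟨S, p, ε₀, h0, fun Ψ' δ b g hb => (HasType.ref (k Ψ' δ b g hb) (g.weaken h2)).up
        g.wf' dom_nil.superset (by simp) (by simpa using g.subset') ?_ (g.union_subset hreg)⟩
      grind
    · obtain ⟨S, p, ε₀, h0, k⟩ := ih2 rfl rfl wf _ rfl
      refine ⟨S, p, ε₀, h0, fun Ψ' δ b g hb => (HasType.ref (g.weaken h1)
        (g.erase (k Ψ' δ b g hb))).up g.wf' dom_nil.superset (by simp) (by simpa using g.subset')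
        ?_ (g.union_subset hreg)⟩
      grind
  | deref h1 ih =>
    subst hΓ hφ
    have hreg := ((HasType.deref h1).regular_nil wf).2.2
    cases E <;> cases ht
    · exact hole (.deref h1)
    · obtain ⟨S, p, ε₀, h0, k⟩ := ih rfl rfl wf _ rfl
      refine ⟨S, p, ε₀, h0, fun Ψ' δ b g hb => (HasType.deref (k Ψ' δ b g hb)).up
        g.wf' dom_nil.superset (by simp) (by simpa using g.subset') ?_ (g.union_subset hreg)⟩
      grind
  | assign h1 h2 ih1 ih2 =>
    subst hΓ hφ
    have hreg := ((HasType.assign h1 h2).regular_nil wf).2.2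
    cases E <;> cases ht
    · exact hole (.assign h1 h2)
    · obtain ⟨S, p, ε₀, h0, k⟩ := ih1 rfl rfl wf _ rfl
      refine ⟨S, p, ε₀, h0, fun Ψ' δ b g hb => (HasType.assign (k Ψ' δ b g hb) (g.weaken h2)).up
        g.wf' dom_nil.superset (by simp) (by simpa using g.subset') ?_ (g.union_subset hreg)⟩
      grind
    · obtain ⟨S, p, ε₀, h0, k⟩ := ih2 rfl rfl wf _ rfl
      refine ⟨S, p, ε₀, h0, fun Ψ' δ b g hb => (HasType.assign (g.weaken h1)
        (g.erase (k Ψ' δ b g hb))).up g.wf' dom_nil.superset (by simp) (by simpa using g.subset')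
        ?_ (g.union_subset hreg)⟩
      grind
  | sub _ hs hq hε ih =>
    subst hΓ hφ
    obtain ⟨S, p, ε₀, h0, k⟩ := ih rfl rfl wf E ht
    refine ⟨S, p, ε₀, h0, fun Ψ' δ b g hb => .sub (k Ψ' δ b g hb)
      ⟨hs.1.mono g.ext.dom_subset, ⟨Finset.union_subset_union_left hs.2.1.1, ?_⟩,
        ⟨Finset.union_subset_union_left hs.2.2.1, ?_⟩⟩ (g.union_subset hq) (g.union_subset hε)⟩
    · exact (g.union_subset hq).trans dom_nil.superset
    · exact (g.union_subset hε).trans dom_nil.superset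

end Grow

variable {Ψ : StoreTy K}

/-! ### Preservation -/

theorem Ty.Scoped.mono_nil {T : Ty K} {k : ℕ} (h : T.Scoped (domS Ψ) k) :
    T.Scoped (dom [] Ψ) k :=
  h.mono dom_nil.superset le_rfl

/-- Substitution of a closed value in the body of an abstraction or of a `let`. -/
theorem HasType.inst_value {φ : Qual} {t s : Term C} {S U : Ty K} {p₀ p r ε : Qual} (wf : WF [] Ψ)
    (L : Finset ℕ) (hS : S.Scoped (domS Ψ) 0) (hp₀ : p₀ ⊆ domS Ψ) (hp : p ⊆ domS Ψ)
    (hφ : φ ⊆ domS Ψ) (hpφ : p ∩ φ ⊆ p₀)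
    (hs : HasType [] Ψ p s S p ∅)
    (h : ∀ x ∉ L, HasType [(x, S, p₀)] Ψ (φ ∪ {.fvar x}) (t.named x) (U.named x) (r.named x)
      (ε.named x)) :
    HasType [] Ψ (φ ∪ p) (t.inst 0 s) (U.inst 0 p) (Qual.inst 0 p r) (Qual.inst 0 p ε) := by
  have wfx x : WF [(x, S, p₀)] Ψ := wf.cons hS.mono_nil (hp₀.trans dom_nil.superset)
  have hφx x : φ ∪ {.fvar x} ⊆ dom [(x, S, p₀)] Ψ :=
    union_singleton_subset_dom_cons (hφ.trans dom_nil.superset)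
  have hU : U.Scoped (domS Ψ) 1 := .of_named L fun x hx =>
    ((h x hx).regular (wfx x) (hφx x)).1.mono (by rw [dom_cons, dom_nil]) le_rfl
  have notMem {q : Qual} (hq : ∀ x ∉ L, q.named x ⊆ φ ∪ {.fvar x}) (x : ℕ) : Atom.fvar x ∉ q := by
    have : Qual.Scoped (domS Ψ) 1 q := .of_named L fun x hx =>
      Qual.scoped_zero.2 ((hq x hx).trans (union_singleton_subset_insert hφ))
    intro h
    rcases this _ h with h | ⟨i, _, h⟩
    · exact fvar_notMem_domS h
    · cases h
  obtain ⟨x, hx⟩ := Infinite.exists_notMem_finset (L ∪ t.fv)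
  rw [Finset.mem_union, not_or] at hx
  have R : Replaces [] Ψ x S p₀ p s := by
    refine ⟨wf, by simp [names], hs, hp.trans dom_nil.superset, hS, hp₀, fun _ h => ?_⟩
    cases h with
    | var hm => simp at hm
    | loc hm hb => simp [wf.flat hm] at hb
  have hx' : Atom.fvar x ∉ φ := fun h => fvar_notMem_domS (hφ h)
  have hxp : Atom.fvar x ∉ p := fun h => fvar_notMem_domS (hp h)
  have hP : p ∩ (φ ∪ {.fvar x}) ⊆ p₀ ∪ {.fvar x} := by
    intro a ha
    have := @hpφ a
    grind
  have := (h x hx.1).subst_aux (Γ := []) rfl (by simp [names]) R (wfx x) (hφx x) hP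
  rw [Term.subst_named_self hx.2, hU.subst_named_self fvar_notMem_domS,
    Qual.subst_named_self (notMem (fun x hx => ((h x hx).regular (wfx x) (hφx x)).2.1) x),
    Qual.subst_named_self (notMem (fun x hx => ((h x hx).regular (wfx x) (hφx x)).2.2) x)] at this
  have hobs : Qual.subst x p (φ ∪ {.fvar x}) = φ ∪ p := by
    ext a
    simp only [Qual.mem_subst, Finset.mem_union, Finset.mem_singleton]
    grind
  rwa [hobs] at this

theorem TSub.inst_named {S : Ty K} {q p : Qual} {U V : Ty K} (L : Finset ℕ)
    (hp : p ⊆ domS Ψ) (hU : U.Scoped (domS Ψ) 1) (hV : V.Scoped (domS Ψ) 1)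
    (h : ∀ x ∉ L, TSub [(x, S, q)] Ψ (U.named x) (V.named x)) :
    TSub [] Ψ (U.inst 0 p) (V.inst 0 p) := by
  obtain ⟨x, hx⟩ := Infinite.exists_notMem_finset L
  have := (h x hx).subst (Γ' := []) (x := x) (hp.trans dom_nil.superset) (fun a ha hax => by
    rw [dom_cons] at ha
    exact Finset.mem_of_mem_insert_of_ne ha hax)
  rwa [hU.subst_named_self fvar_notMem_domS, hV.subst_named_self fvar_notMem_domS] at this

theorem inst_subset_of_forall_named {p q r D : Qual} (L : Finset ℕ)
    (hq : Qual.Scoped D 1 q) (hr : Qual.Scoped D 1 r) (hD : ∀ x, Atom.fvar x ∉ D)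
    (h : ∀ x ∉ L, q.named x ⊆ r.named x) : Qual.inst 0 p q ⊆ Qual.inst 0 p r := by
  have key {q : Qual} (hq : Qual.Scoped D 1 q) (x : ℕ) : Atom.fvar x ∉ q := by
    intro h
    rcases hq _ h with h | ⟨i, _, h⟩
    · exact hD _ h
    · cases h
  obtain ⟨x, hx⟩ := Infinite.exists_notMem_finset L
  have := Qual.subst_mono (x := x) (p := p) (h x hx)
  rwa [Qual.subst_named_self (key hq x), Qual.subst_named_self (key hr x)] at this

theorem HasType.beta (wf : WF [] Ψ) {φ : Qual} {a t s : Term C} {T : Ty K} {q ε : Qual}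
    (h : HasType [] Ψ φ a T q ε) (hφ : φ = domS Ψ) (ha : a = .app (.lam t) s) (hs : Value s) :
    HasType [] Ψ φ (t.inst 0 s) T q ε := by
  generalize hΓ : ([] : Ctx K) = Γ at h
  induction h with
  | @app Γ Ψ φ t₁ t₂ T U p q r ε₁ ε₂ ε₃ h1 h2 hp hq hU hε hr _ _ =>
    subst hΓ hφ
    cases ha
    obtain ⟨_, hreg, hreg'⟩ := (HasType.app h1 h2 hp hq hU hε hr).regular_nil wf
    obtain ⟨⟨_, _, hε₃, hUs, hrs⟩, hq1, _⟩ := h1.regular_nil wf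
    obtain ⟨_, hp1, _⟩ := h2.regular_nil wf
    obtain ⟨T', U', p', r', ε', q', L, hT', hp', hb, hq', hsub⟩ :=
      h1.lam_inv wf dom_nil.superset
    obtain ⟨⟨_, _, hε's, hUs', hrs'⟩, _⟩ := hsub.scoped
    rw [dom_nil] at hε's hUs' hrs' hT' hp'
    cases hsub with
    | fn L' g1 g2 g3 g4 g5 =>
      have hv := (h2.value hs wf dom_nil.superset)
      have hv' : HasType [] Ψ p s T' p ∅ := .sub hv ⟨g1, ⟨subset_rfl, hp1.trans dom_nil.superset⟩,
        ⟨subset_rfl, by simp⟩⟩ subset_rfl (by simp)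
      have hpq : p ∩ q' ⊆ p' := by
        refine Finset.Subset.trans ?_ g2.1
        rw [wf.sat_nil, wf.sat_nil]
        exact Finset.inter_subset_inter_left hq'
      have key := HasType.inst_value wf L hT' hp' hp1 (hq'.trans hq1) hpq hv' hb
      have hobs := Finset.union_subset (hq'.trans hq1) hp1
      refine .sub (key.weaken wf (hobs.trans dom_nil.superset) .rfl wf hobs dom_nil.superset)
        ⟨TSub.inst_named L' hp1 hUs' hUs g3, ⟨?_, hreg.trans dom_nil.superset⟩,
          ⟨?_, hreg'.trans dom_nil.superset⟩⟩ hreg hreg'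
      · exact inst_subset_of_forall_named L' hrs' hrs (fun _ => fvar_notMem_domS)
          fun x hx => (g4 x hx).1
      · exact (inst_subset_of_forall_named L' hε's hε₃ (fun _ => fvar_notMem_domS)
          fun x hx => (g5 x hx).1).trans Finset.subset_union_right
  | sub _ hs' hq hε ih =>
    exact .sub (ih wf hφ ha hΓ) hs' hq hε
  | _ => cases ha

theorem HasType.let_beta (wf : WF [] Ψ) {φ : Qual} {a t s : Term C} {T : Ty K} {q ε : Qual}
    (h : HasType [] Ψ φ a T q ε) (hφ : φ = domS Ψ) (ha : a = .letin s t) (hs : Value s) :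
    HasType [] Ψ φ (t.inst 0 s) T q ε := by
  generalize hΓ : ([] : Ctx K) = Γ at h
  induction h with
  | @letin Γ Ψ φ t₁ t₂ S T p q ε₁ ε₂ L h1 h2 hT _ _ =>
    subst hΓ hφ
    cases ha
    obtain ⟨_, hreg, hreg'⟩ := (HasType.letin L h1 h2 hT).regular_nil wf
    obtain ⟨hS, hp, _⟩ := h1.regular_nil wf
    have ho : sat [] Ψ p ∩ sat [] Ψ (domS Ψ) = p := by
      rw [wf.sat_nil, wf.sat_nil, Finset.inter_eq_left]
      exact hp
    have key := HasType.inst_value wf L hS (ho.subset.trans hp) hp subset_rfl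
      (Finset.inter_subset_left.trans ho.superset) (h1.value hs wf dom_nil.superset) h2
    rw [Finset.union_eq_left.2 hp] at key
    exact key.up wf dom_nil.superset subset_rfl hreg Finset.subset_union_right hreg'
  | sub _ hs' hq hε ih =>
    exact .sub (ih wf hφ ha hΓ) hs' hq hε
  | _ => cases ha

theorem HasType.ref_inv {Γ : Ctx K} {φ : Qual} {t₁ t₂ : Term C} {T : Ty K} {q ε : Qual}
    (h : HasType Γ Ψ φ (.ref t₁ t₂) T q ε) :
    ∃ B ε₂, HasType Γ Ψ φ t₂ (.base B) ∅ ε₂ ∧ T = .ref B := by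
  generalize ha : Term.ref t₁ t₂ = a at h
  induction h with
  | ref _ h2 =>
    cases ha
    exact ⟨_, _, h2, rfl⟩
  | sub _ hs _ _ ih =>
    obtain ⟨B, ε₂, h2, rfl⟩ := ih ha
    obtain ⟨hs, _⟩ := hs
    cases hs
    exact ⟨B, ε₂, h2, rfl⟩
  | _ => cases ha

theorem HasType.deref_inv {Γ : Ctx K} {φ : Qual} {t : Term C} {T : Ty K} {q ε : Qual}
    (h : HasType Γ Ψ φ (.deref t) T q ε) :
    ∃ B q' ε', HasType Γ Ψ φ t (.ref B) q' ε' ∧ T = .base B := by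
  generalize ha : Term.deref t = a at h
  induction h with
  | deref h =>
    cases ha
    exact ⟨_, _, _, h, rfl⟩
  | sub _ hs _ _ ih =>
    obtain ⟨B, q', ε', h, rfl⟩ := ih ha
    obtain ⟨hs, _⟩ := hs
    cases hs
    exact ⟨B, q', ε', h, rfl⟩
  | _ => cases ha

theorem HasType.assign_inv {Γ : Ctx K} {φ : Qual} {t₁ t₂ : Term C} {T : Ty K} {q ε : Qual}
    (h : HasType Γ Ψ φ (.assign t₁ t₂) T q ε) :
    ∃ B q' ε₁ ε₂, HasType Γ Ψ φ t₁ (.ref B) q' ε₁ ∧ HasType Γ Ψ φ t₂ (.base B) ∅ ε₂ ∧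
      T = .base .unit := by
  generalize ha : Term.assign t₁ t₂ = a at h
  induction h with
  | assign h1 h2 =>
    cases ha
    exact ⟨_, _, _, _, h1, h2, rfl⟩
  | sub _ hs _ _ ih =>
    obtain ⟨B, q', ε₁, ε₂, h1, h2, rfl⟩ := ih ha
    obtain ⟨hs, _⟩ := hs
    cases hs
    exact ⟨B, q', ε₁, ε₂, h1, h2, rfl⟩
  | _ => cases ha

theorem HasType.loc_ref_inv {Γ : Ctx K} {φ : Qual} {l : ℕ} {B : Base K} {q ε : Qual}
    (h : HasType (C := C) Γ Ψ φ (.loc l) (.ref B) q ε) : ∃ r, (l, .ref B, r) ∈ Ψ := by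
  obtain ⟨S, r, hm, rfl | hS, _⟩ := h.loc_inv
  · exact ⟨r, hm⟩
  · cases hS
    exact ⟨r, hm⟩

/-- Contraction of a redex preserves its type, up to a newly allocated location. -/
theorem Head.preservation {σ σ' : Store C} {t t' : Term C} {T : Ty K} {q ε : Qual}
    (hr : Head σ t σ' t') (h : HasType [] Ψ (domS Ψ) t T q ε)
    (hσ : StoreOK [] (domS Ψ) Ψ σ) :
    ∃ Ψ' δ, Grow Ψ Ψ' δ ∧ HasType [] Ψ' (domS Ψ') t' T (q ∪ δ) (ε ∪ δ) ∧
      StoreOK [] (domS Ψ') Ψ' σ' := by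
  have wf := hσ.wf
  obtain ⟨_, hq, hε⟩ := h.regular_nil wf
  cases hr with
  | beta hs =>
    exact ⟨Ψ, ∅, .refl wf, by simpa using h.beta wf rfl rfl hs, hσ⟩
  | letin hs =>
    exact ⟨Ψ, ∅, .refl wf, by simpa using h.let_beta wf rfl rfl hs, hσ⟩
  | @ref _ a s l _ hs hl =>
    obtain ⟨B, ε₂, h2, rfl⟩ := h.ref_inv
    have hl := hσ.loc_notMem hl
    obtain ⟨c, rfl, rfl⟩ := h2.const_of_value hs
    have g := Grow.ref wf hl c.ty
    refine ⟨_, _, g, ?_, .ref (hσ.observe _) hs (.cst c) hl⟩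
    exact (HasType.loc List.mem_cons_self (by simp)).up g.wf' dom_nil.superset
      Finset.subset_union_right (g.union_subset hq) (by simp) (g.union_subset hε)
  | @deref σ₁ σ₂ l s =>
    obtain ⟨B, q', ε', h1, rfl⟩ := h.deref_inv
    obtain ⟨r, hm⟩ := h1.loc_ref_inv
    obtain ⟨c, rfl, hm'⟩ := hσ.lookup (List.mem_append_right _ List.mem_cons_self)
    cases hσ.unique hm hm'
    refine ⟨Ψ, ∅, .refl wf, ?_, hσ⟩
    rw [Finset.union_empty, Finset.union_empty]
    exact (HasType.cst c).up wf dom_nil.superset (by simp) hq (by simp) hε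
  | @assign σ₁ σ₂ l s s' hs =>
    obtain ⟨B, q', ε₁, ε₂, h1, h2, rfl⟩ := h.assign_inv
    obtain ⟨r, hm⟩ := h1.loc_ref_inv
    obtain ⟨c, rfl, hm'⟩ := hσ.lookup (List.mem_append_right _ List.mem_cons_self)
    obtain ⟨c', rfl, hc'⟩ := h2.const_of_value hs
    have hc := hσ.unique hm hm'
    simp only [Ty.ref.injEq] at hc
    refine ⟨Ψ, ∅, .refl wf, ?_, hσ.update (hc'.trans hc)⟩
    rw [Finset.union_empty, Finset.union_empty]
    exact (HasType.cst Const.unit).up wf dom_nil.superset (by simp) hq (by simp) hε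

end LStar

theorem mainTheorem6 {K : Type*} {C : K → Type*}
    (Ψ : LStar.StoreTy K) (σ σ' : LStar.Store C) (t t' : LStar.Term C)
    (T : LStar.Ty K) (q ε : LStar.Qual)
    (ht : LStar.HasType [] Ψ (LStar.domS Ψ) t T q ε)
    (hσ : LStar.StoreOK [] (LStar.domS Ψ) Ψ σ)
    (hstep : LStar.Step σ t σ' t') :
    ∃ Ψ' : LStar.StoreTy K, Ψ ⊆ Ψ' ∧
      ∃ p : LStar.Qual, p ⊆ LStar.domS Ψ' \ LStar.domS Ψ ∧
        LStar.HasType [] Ψ' (LStar.domS Ψ') t' T (q ∪ p) (ε ∪ p) ∧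
        LStar.StoreOK [] (LStar.domS Ψ') Ψ' σ' := by
  cases hstep with
  | ctx E hr =>
    obtain ⟨S, p, ε₀, h0, k⟩ := ht.plug rfl rfl hσ.wf E _ rfl
    obtain ⟨Ψ', δ, g, hb, hσ'⟩ := hr.preservation h0 hσ
    exact ⟨Ψ', g.subset, δ, g.qual_subset, k Ψ' δ _ g hb, hσ'⟩
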